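/- Let $n\ge 2$ and $\ell\ge 1$ be integers. For $k\ge1$ let $B_{(k)}$ be the $sl_n$ crystal of one-row semistandard tableaux of length $k$ with letters $1,\dots,n$: for $1\le i\le n-1$, $\tilde f_i(b)$ is obtained by replacing the rightmost $i$ of $b$ by $i+1$ (and $\tilde f_i(b)=0$ if $b$ contains no $i$), $\varphi_i(b)$ is the number of letters $i$ in $b$, and $\varepsilon_i(b)$ is the number of letters $i+1$ in $b$. Let $B_{(1,1)}$ be the $sl_n$ crystal of columns with letters $1\le\alpha<\beta\le n$: if $i$ appears in $b$ and $i+1$ does not, then $\tilde f_i(b)$ is obtained by replacing $i$ by $i+1$, and otherwise $\tilde f_i(b)=0$; $\varphi_i(b)$ is $1$ if $i$ appears in $b$ and $i+1$ does not, and $0$ otherwise; $\varepsilon_i(b)$ is $1$ if $i+1$ appears in $b$ and $i$ does not, and $0$ otherwise. On a tensor product (as a set, the direct product) put $$\tilde f_i(b\otimes b')=\begin{cases}\tilde f_i b\otimes b' & \text{if }\varphi_i(b)>\varepsilon_i(b'),\\ b\otimes\tilde f_i b' & \text{if }\varphi_i(b)\le\varepsilon_i(b'),\end{cases}$$ where $0\otimes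 b'$ and $b\otimes 0$ mean $0$. An isomorphism of crystals is a bijection that commutes with all $\tilde f_i$ (and sends $0$ to $0$). For any two shapes $\lambda,\mu\in\{(\ell),(1),(1,1)\}$ there is exactly one isomorphism of crystals $\sigma: B_\lambda\otimes B_\mu\to B_\mu\otimes B_\lambda$. For a tensor product $\mathcal B=B_{\lambda_1}\otimes\cdots\otimes B_{\lambda_N}$ with each $\lambda_j\in\{(\ell),(1),(1,1)\}$ and for $1\le i\le N-1$, let $$\sigma_i(b_1\otimes\cdots\otimes b_N)=b_1\otimes\cdots\otimes\sigma(b_i\otimes b_{i+1})\otimes\cdots\otimes b_N ,$$ an element of the tensor product with the factors $\lambda_i,\lambda_{i+1}$ exchanged. Then the maps $\sigma_i$ satisfy the Coxeter relations of the symmetric group on every such $\mathcal B$: $$\sigma_i^2=\mathrm{Id},\qquad \sigma_i\sigma_j=\sigma_j\sigma_i\ \text{ if } |i-j|\ge 2,\qquad \sigma_i\sigma_{i+1}\sigma_i=\sigma_{i+1}\sigma_i\sigma_{i+1}$$ for all indices for which these maps are defined. -/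

import Mathlib

/-- The data `f̃_i`, `ε_i`, `φ_i` (`i` in the index set of `sl_n`) of an `sl_n` crystal with
underlying set `B`.  The extra element `0` is `none`, so `f̃_i b = 0` reads `f i b = none`.
The index set `{1, …, n - 1}` is `Fin (n - 1)`, shifted by one. -/
structure CrystalData (n : ℕ) (B : Type) where
  f : Fin (n - 1) → B → Option B
  eps : Fin (n - 1) → B → ℕ
  phi : Fin (n - 1) → B → ℕ

/-- The letter `i`, for `i` in the index set.  The letters `1, …, n` are `Fin n`,
shifted by one. -/
def letter {n : ℕ} (i : Fin (n - 1)) : Fin n := ⟨i.1, by omega⟩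

/-- The letter `i + 1`, for `i` in the index set. -/
def nextLetter {n : ℕ} (i : Fin (n - 1)) : Fin n := ⟨i.1 + 1, by omega⟩

theorem letter_ne_nextLetter {n : ℕ} (i : Fin (n - 1)) : letter i ≠ nextLetter i := by
  simp [letter, nextLetter]

/-- Semistandard tableaux with a single row of length `k` and letters in `Fin n`.  Such a tableau
is written as `(x_1, …, x_n)`, where `x_a` is the number of letters `a` in it: the row itself is
`1 … 1 2 … 2 ⋯ n … n` with `x_a` copies of `a`. -/
def RowTableau (n k : ℕ) : Type := {x : Fin n → ℕ // ∑ a, x a = k}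

/-- Replace one letter `i` (necessarily the rightmost one) of a row by `i + 1`. -/
def RowTableau.replace {n k : ℕ} (i : Fin (n - 1)) (x : RowTableau n k)
    (h : 0 < x.1 (letter i)) : RowTableau n k :=
  ⟨fun a => if a = letter i then x.1 a - 1
      else if a = nextLetter i then x.1 a + 1 else x.1 a, by
    have hne := letter_ne_nextLetter i
    have key : ∀ a, (if a = letter i then x.1 a - 1
        else if a = nextLetter i then x.1 a + 1 else x.1 a) + (if a = letter i then 1 else 0)
        = x.1 a + (if a = nextLetter i then 1 else 0) := by
      intro a
      by_cases h1 : a = letter i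
      · subst h1
        simp only [if_true, if_neg hne]
        omega
      · by_cases h2 : a = nextLetter i
        · subst h2
          simp [hne.symm]
        · simp [h1, h2]
    have hs := Finset.sum_congr (rfl : (Finset.univ : Finset (Fin n)) = Finset.univ)
      (fun a _ => key a)
    rw [Finset.sum_add_distrib, Finset.sum_add_distrib, x.2] at hs
    simpa using hs⟩

/-- The crystal `B_k = B_{(k)}`: `f̃_i` replaces the rightmost `i` by `i + 1` if there is an `i`,
and gives `0` otherwise; `φ_i` counts the letters `i` and `ε_i` the letters `i + 1`. -/
def rowCrystal (n k : ℕ) : CrystalData n (RowTableau n k) where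
  f i x := if h : 0 < x.1 (letter i) then some (x.replace i h) else none
  eps i x := x.1 (nextLetter i)
  phi i x := x.1 (letter i)

/-- Semistandard tableaux of column shape `(1,1)`: a letter `top` above a larger
letter `bottom`. -/
structure ColTableau (n : ℕ) : Type where
  top : Fin n
  bottom : Fin n
  lt : top < bottom

/-- The letter `a` appears in the column `b`. -/
def ColTableau.Has {n : ℕ} (b : ColTableau n) (a : Fin n) : Prop := b.top = a ∨ b.bottom = a

instance {n : ℕ} (b : ColTableau n) (a : Fin n) : Decidable (b.Has a) :=
  inferInstanceAs (Decidable (_ ∨ _))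

/-- Replace the letter `i` of a column that has `i` but not `i + 1` by `i + 1`. -/
def ColTableau.replace {n : ℕ} (i : Fin (n - 1)) (b : ColTableau n)
    (h : b.Has (letter i) ∧ ¬ b.Has (nextLetter i)) : ColTableau n where
  top := if b.top = letter i then nextLetter i else b.top
  bottom := if b.bottom = letter i then nextLetter i else b.bottom
  lt := by
    obtain ⟨t, u, hlt⟩ := b
    simp only [ColTableau.Has, letter, nextLetter, Fin.ext_iff, Fin.lt_def] at *
    split_ifs <;> simp_all only [Fin.lt_def] <;> omega

/-- The crystal `B_♮ = B_{(1,1)}`: if `i` appears and `i + 1` does not, `f̃_i` replaces `i`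
by `i + 1`; otherwise it gives `0`. -/
def colCrystal (n : ℕ) : CrystalData n (ColTableau n) where
  f i b := if h : b.Has (letter i) ∧ ¬ b.Has (nextLetter i) then some (b.replace i h) else none
  eps i b := if b.Has (nextLetter i) ∧ ¬ b.Has (letter i) then 1 else 0
  phi i b := if b.Has (letter i) ∧ ¬ b.Has (nextLetter i) then 1 else 0

/-- The tensor product of two crystals, on the product of the underlying sets.  The truncated
subtractions are harmless: a negative value would not contribute to the maximum. -/
def CrystalData.tensor {n : ℕ} {B C : Type} (X : CrystalData n B) (Y : CrystalData n C) :
    CrystalData n (B × C) where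
  f i p := if Y.eps i p.2 < X.phi i p.1 then (X.f i p.1).map (fun b => (b, p.2))
    else (Y.f i p.2).map (fun c => (p.1, c))
  eps i p := max (X.eps i p.1) (X.eps i p.1 + Y.eps i p.2 - X.phi i p.1)
  phi i p := max (Y.phi i p.2) (X.phi i p.1 + Y.phi i p.2 - Y.eps i p.2)

/-- `g` is an isomorphism of `sl_n` crystals: a bijection that commutes with all `f̃_i`
(where `g 0 = 0`). -/
def IsCrystalIso {n : ℕ} {B C : Type} (X : CrystalData n B) (Y : CrystalData n C)
    (g : B → C) : Prop :=
  Function.Bijective g ∧ ∀ i b, Y.f i (g b) = (X.f i b).map g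

/-- The shapes `(k)` (`row k`) and `(1,1)` (`col`). -/
inductive CrystalShape : Type
  | row (k : ℕ)
  | col

/-- The set `B_λ` of semistandard tableaux of shape `λ` with `n` letters. -/
def Tab (n : ℕ) : CrystalShape → Type
  | .row k => RowTableau n k
  | .col => ColTableau n

/-- The crystal structure of `B_λ`. -/
def tabCrystal (n : ℕ) : (s : CrystalShape) → CrystalData n (Tab n s)
  | .row k => rowCrystal n k
  | .col => colCrystal n

/-- `g` is an isomorphism of crystals from `B_s ⊗ B_t` to `B_t ⊗ B_s`. -/
def IsTensorIso (n : ℕ) (s t : CrystalShape) (g : Tab n s × Tab n t → Tab n t × Tab n s) : Prop :=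
  IsCrystalIso ((tabCrystal n s).tensor (tabCrystal n t))
    ((tabCrystal n t).tensor (tabCrystal n s)) g

/-- The map `σ : B_s ⊗ B_t → B_t ⊗ B_s`: the isomorphism of crystals.  (That there is exactly one
is not built into this definition.) -/
noncomputable def combR (n : ℕ) (s t : CrystalShape) :
    Tab n s × Tab n t → Tab n t × Tab n s :=
  @Classical.epsilon _ ⟨Prod.swap⟩ (IsTensorIso n s t)

/-- The elements `b_1 ⊗ ⋯ ⊗ b_N` of all the tensor products `B_{λ_1} ⊗ ⋯ ⊗ B_{λ_N}`: each
factor carries its shape `λ_j` together with the element `b_j` of `B_{λ_j}`. -/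
abbrev TensorElt (n N : ℕ) : Type := Fin N → Σ s : CrystalShape, Tab n s

/-- The map `σ_i`, which applies `σ` to the neighbouring factors at the positions `i` and `i + 1`
(positions are counted from `0`), so that it maps `B_{λ_1} ⊗ ⋯ ⊗ B_{λ_N}` to the product with
these two factors exchanged. -/
noncomputable def localR {n N : ℕ} (i : ℕ) (hi : i + 1 < N) (p : TensorElt n N) :
    TensorElt n N :=
  let x := p ⟨i, by omega⟩
  let y := p ⟨i + 1, hi⟩
  let r := combR n x.1 y.1 (x.2, y.2)
  fun j => if j.1 = i then ⟨y.1, r.1⟩ else if j.1 = i + 1 then ⟨x.1, r.2⟩ else p j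

/-- The shapes `(ℓ)`, `(1)`, `(1,1)`. -/
def basicShapes (l : ℕ) : Set CrystalShape := {.row l, .row 1, .col}

/-! A map commuting with all `f̃_i` is determined by its values on highest elements, those with all
`ε_i = 0`, because every other element is reached from these by lowering operators (`Commutes.ext`).
Both uniqueness of `σ` and the braid relation are reduced to highest elements in this way.

Uniqueness: an isomorphism preserves `ε_i` and `φ_i`, and in a product of two of the factors a
highest element is determined by its `φ_i` (multiplicity-freeness), so two isomorphisms agree
(`tensorIso_unique`). Then `σ` is the identity on equal shapes and is involutive.

Existence: for a row against a letter or a column, `σ` is given by an explicit content-preserving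
rule (`RowLetterRel`, `RowColRel`). The rule is total, injective and compatible with `f̃_i`;
finiteness and equal cardinality make it the graph of a bijection. The remaining orders of the
factors use the inverse maps.

Braid relation: if two of the three shapes agree, it follows from `σ = id` there and involutivity.
For distinct shapes, conjugation by the involutions reduces every order to `(ℓ), (1), (1,1)`. In
that product highest elements are no longer determined by weight: for `n ≥ 3`, with letters written
`1, …, n`, both `1^ℓ ⊗ 1 ⊗ {2,3}` and `1^ℓ ⊗ 2 ⊗ {1,3}` have the same one. So both sides are
computed by the explicit rules on the at most six highest elements (`highest_triple`,
`yangBaxterAt_highest`). -/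

namespace CrystalData

/-! ### Regular crystals and maps commuting with the lowering operators -/

/-- The crystal axioms that are used: `φ_i` and `ε_i` measure the `i`-strings, and the crystal is
graded, so that every element is reached from an element with all `ε_i = 0`. -/
structure Regular {n : ℕ} {B : Type} (X : CrystalData n B) : Prop where
  f_eq_none : ∀ i b, X.f i b = none ↔ X.phi i b = 0
  phi_f : ∀ i b b', X.f i b = some b' → X.phi i b = X.phi i b' + 1
  eps_f : ∀ i b b', X.f i b = some b' → X.eps i b' = X.eps i b + 1
  exists_f : ∀ i b, 0 < X.eps i b → ∃ b', X.f i b' = some b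
  exists_grade : ∃ m : B → ℕ, ∀ i b b', X.f i b = some b' → m b < m b'

/-- `g` commutes with all `f̃_i`. -/
def Commutes {n : ℕ} {B C : Type} (X : CrystalData n B) (Y : CrystalData n C) (g : B → C) :
    Prop :=
  ∀ i b, Y.f i (g b) = (X.f i b).map g

theorem Commutes.comp {n : ℕ} {B C D : Type} {X : CrystalData n B} {Y : CrystalData n C}
    {Z : CrystalData n D} {h : C → D} {g : B → C} (hh : Commutes Y Z h) (hg : Commutes X Y g) :
    Commutes X Z (h ∘ g) := by
  intro i b
  simp only [Function.comp]
  rw [hh, hg, Option.map_map]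

theorem tensor_f_eq_some {n : ℕ} {B C : Type} (X : CrystalData n B) (Y : CrystalData n C)
    (i : Fin (n - 1)) (p q : B × C) :
    (X.tensor Y).f i p = some q ↔
      (Y.eps i p.2 < X.phi i p.1 ∧ X.f i p.1 = some q.1 ∧ p.2 = q.2) ∨
      (X.phi i p.1 ≤ Y.eps i p.2 ∧ p.1 = q.1 ∧ Y.f i p.2 = some q.2) := by
  obtain ⟨b, c⟩ := p
  obtain ⟨b', c'⟩ := q
  simp only [tensor]
  split_ifs with h
  · simp only [Option.map_eq_some_iff, Prod.mk.injEq]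
    grind
  · simp only [Option.map_eq_some_iff, Prod.mk.injEq]
    grind

/-- The signature rule: when `f̃_i` acts on one factor, its effect on `ε_i` and `φ_i` of that factor
leaves the same branch of the maxima in force. A preimage under `f̃_i` is sought in the left factor
exactly when `ε_i(c) ≤ φ_i(b)`. Gradings add. -/
theorem Regular.tensor {n : ℕ} {B C : Type} {X : CrystalData n B} {Y : CrystalData n C}
    (hX : X.Regular) (hY : Y.Regular) : (X.tensor Y).Regular where
  f_eq_none := by
    rintro i ⟨b, c⟩
    have h1 := hX.f_eq_none i b
    have h2 := hY.f_eq_none i c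
    simp only [CrystalData.tensor]
    split_ifs with h
    · rw [Option.map_eq_none_iff, h1]; omega
    · rw [Option.map_eq_none_iff, h2]; omega
  phi_f := by
    rintro i ⟨b, c⟩ ⟨b', c'⟩ h
    rcases (tensor_f_eq_some X Y i _ _).1 h with ⟨h1, h2, h3⟩ | ⟨h1, h2, h3⟩
    · have := hX.phi_f i _ _ h2
      have := hX.eps_f i _ _ h2
      simp only [CrystalData.tensor] at *
      subst h3
      omega
    · have := hY.phi_f i _ _ h3
      have := hY.eps_f i _ _ h3
      simp only [CrystalData.tensor] at *
      subst h2
      omega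
  eps_f := by
    rintro i ⟨b, c⟩ ⟨b', c'⟩ h
    rcases (tensor_f_eq_some X Y i _ _).1 h with ⟨h1, h2, h3⟩ | ⟨h1, h2, h3⟩
    · have := hX.phi_f i _ _ h2
      have := hX.eps_f i _ _ h2
      simp only [CrystalData.tensor] at *
      subst h3
      omega
    · have := hY.phi_f i _ _ h3
      have := hY.eps_f i _ _ h3
      simp only [CrystalData.tensor] at *
      subst h2
      omega
  exists_f := by
    rintro i ⟨b, c⟩ h
    simp only [CrystalData.tensor] at h
    by_cases hc : Y.eps i c ≤ X.phi i b
    · obtain ⟨b', hb'⟩ := hX.exists_f i b (by omega)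
      have := hX.phi_f i _ _ hb'
      exact ⟨(b', c), (tensor_f_eq_some X Y i _ _).2 (Or.inl ⟨by simp only; omega, hb', rfl⟩)⟩
    · obtain ⟨c', hc'⟩ := hY.exists_f i c (by omega)
      have := hY.eps_f i _ _ hc'
      exact ⟨(b, c'), (tensor_f_eq_some X Y i _ _).2 (Or.inr ⟨by simp only; omega, rfl, hc'⟩)⟩
  exists_grade := by
    obtain ⟨m, hm⟩ := hX.exists_grade
    obtain ⟨m', hm'⟩ := hY.exists_grade
    refine ⟨fun p => m p.1 + m' p.2, ?_⟩
    rintro i ⟨b, c⟩ ⟨b', c'⟩ h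
    rcases (tensor_f_eq_some X Y i _ _).1 h with ⟨h1, h2, h3⟩ | ⟨h1, h2, h3⟩
    · have := hm i _ _ h2
      simp only at *
      subst h3
      omega
    · have := hm' i _ _ h3
      simp only at *
      subst h2
      omega

/-- In a regular crystal `φ_i` counts how often `f̃_i` applies before reaching `0`, which a
commuting map preserves even without bijectivity. -/
theorem Commutes.phi_eq {n : ℕ} {B C : Type} {X : CrystalData n B} {Y : CrystalData n C}
    (hX : X.Regular) (hY : Y.Regular) {g : B → C} (hg : Commutes X Y g) (i : Fin (n - 1)) (b : B) :
    Y.phi i (g b) = X.phi i b := by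
  induction hk : X.phi i b generalizing b with
  | zero =>
    have h := hg i b
    rw [(hX.f_eq_none i b).2 hk] at h
    exact (hY.f_eq_none i _).1 h
  | succ k ih =>
    have h := hg i b
    cases hb : X.f i b with
    | none => rw [hX.f_eq_none] at hb; omega
    | some b' =>
      rw [hb] at h
      have h1 := hX.phi_f i _ _ hb
      rw [hY.phi_f i _ _ h, ih b' (by omega)]

/-- Two maps that commute with all `f̃_i` are equal if they agree on the elements with all
`ε_i = 0`. -/
theorem Commutes.ext {n : ℕ} {B C : Type} {X : CrystalData n B} {Y : CrystalData n C}
    (hX : X.Regular) {g g' : B → C} (hg : Commutes X Y g) (hg' : Commutes X Y g')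
    (h : ∀ b, (∀ i, X.eps i b = 0) → g b = g' b) : g = g' := by
  obtain ⟨m, hm⟩ := hX.exists_grade
  funext b
  induction hk : m b using Nat.strong_induction_on generalizing b with
  | _ k ih =>
    by_cases hb : ∀ i, X.eps i b = 0
    · exact h b hb
    · push Not at hb
      obtain ⟨i, hi⟩ := hb
      obtain ⟨b', hb'⟩ := hX.exists_f i b (by omega)
      have h1 := hg i b'
      have h2 := hg' i b'
      rw [ih (m b') (hk ▸ hm i _ _ hb') b' rfl, h2, hb'] at h1
      simpa using h1.symm

end CrystalData

open CrystalData

/-! ### Isomorphisms, tensor functoriality and associativity -/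

/-- `ε_i` counts steps backwards along an `i`-string, so bijectivity is needed: a predecessor of `g
b` in the target must be pulled back to a predecessor of `b`. -/
theorem IsCrystalIso.eps_eq {n : ℕ} {B C : Type} {X : CrystalData n B} {Y : CrystalData n C}
    (hX : X.Regular) (hY : Y.Regular) {g : B → C} (hg : IsCrystalIso X Y g) (i : Fin (n - 1))
    (b : B) : Y.eps i (g b) = X.eps i b := by
  induction hk : X.eps i b generalizing b with
  | zero =>
    by_contra h
    obtain ⟨c, hc⟩ := hY.exists_f i (g b) (by omega)
    obtain ⟨b', rfl⟩ := hg.1.2 c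
    rw [hg.2, Option.map_eq_some_iff] at hc
    obtain ⟨b'', h1, h2⟩ := hc
    rw [hg.1.1 h2] at h1
    have := hX.eps_f i _ _ h1
    omega
  | succ k ih =>
    obtain ⟨b', hb'⟩ := hX.exists_f i b (by omega)
    have h1 := hX.eps_f i _ _ hb'
    have h2 : Y.f i (g b') = some (g b) := by rw [hg.2, hb']; rfl
    rw [hY.eps_f i _ _ h2, ih b' (by omega)]

theorem IsCrystalIso.id {n : ℕ} {B : Type} (X : CrystalData n B) : IsCrystalIso X X id :=
  ⟨Function.bijective_id, fun i b => by simp⟩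

theorem IsCrystalIso.of_inverse {n : ℕ} {B C : Type} {X : CrystalData n B} {Y : CrystalData n C}
    {g : B → C} (hg : IsCrystalIso X Y g) {h : C → B} (hgh : Function.RightInverse h g) :
    IsCrystalIso Y X h := by
  have hhg : Function.LeftInverse h g := fun b => hg.1.1 (hgh (g b))
  refine ⟨⟨hgh.injective, hhg.surjective⟩, fun i c => ?_⟩
  obtain ⟨b, rfl⟩ := hg.1.2 c
  rw [hg.2, Option.map_map, hhg b]
  cases X.f i b with
  | none => rfl
  | some b' => simp [hhg b']

theorem IsCrystalIso.comp {n : ℕ} {B C D : Type} {X : CrystalData n B} {Y : CrystalData n C}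
    {Z : CrystalData n D} {h : C → D} {g : B → C} (hh : IsCrystalIso Y Z h)
    (hg : IsCrystalIso X Y g) : IsCrystalIso X Z (h ∘ g) :=
  ⟨hh.1.comp hg.1, Commutes.comp hh.2 hg.2⟩

/-- Two isomorphisms agree if elements with all `ε_i = 0` of the target are determined by their
`φ_i`. -/
theorem IsCrystalIso.unique {n : ℕ} {B C : Type} {X : CrystalData n B} {Y : CrystalData n C}
    (hX : X.Regular) (hY : Y.Regular)
    (h : ∀ c c', (∀ i, Y.eps i c = 0) → (∀ i, Y.eps i c' = 0) → (∀ i, Y.phi i c = Y.phi i c') →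
      c = c')
    {g g' : B → C} (hg : IsCrystalIso X Y g) (hg' : IsCrystalIso X Y g') : g = g' := by
  refine Commutes.ext hX hg.2 hg'.2 fun b hb => h _ _ (fun i => ?_) (fun i => ?_) fun i => ?_
  · rw [hg.eps_eq hX hY, hb]
  · rw [hg'.eps_eq hX hY, hb]
  · rw [Commutes.phi_eq hX hY hg.2, Commutes.phi_eq hX hY hg'.2]

/-- The tensor rule sees the left factor only through `φ_i`, so commuting with `f̃_i` suffices here;
on the right factor it sees `ε_i`, and `IsCrystalIso.map_right` asks for an isomorphism. -/
theorem CrystalData.Commutes.map_left {n : ℕ} {B C D : Type} {X : CrystalData n B}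
    {Y : CrystalData n C} (hX : X.Regular) (hY : Y.Regular) (Z : CrystalData n D) {g : B → C}
    (hg : Commutes X Y g) :
    Commutes (X.tensor Z) (Y.tensor Z) (fun p => (g p.1, p.2)) := by
  rintro i ⟨b, d⟩
  simp only [tensor, hg.phi_eq hX hY, hg i b]
  split_ifs <;> simp only [Option.map_map] <;> rfl

theorem IsCrystalIso.map_right {n : ℕ} {B C D : Type} {X : CrystalData n B}
    {Y : CrystalData n C} (hX : X.Regular) (hY : Y.Regular) (Z : CrystalData n D) {g : B → C}
    (hg : IsCrystalIso X Y g) :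
    Commutes (Z.tensor X) (Z.tensor Y) (fun p => (p.1, g p.2)) := by
  rintro i ⟨d, b⟩
  simp only [tensor, hg.eps_eq hX hY, hg.2 i b]
  split_ifs <;> simp only [Option.map_map] <;> rfl

theorem CrystalData.Commutes.assoc {n : ℕ} {B C D : Type} {X : CrystalData n B}
    {Y : CrystalData n C} {Z : CrystalData n D} :
    Commutes ((X.tensor Y).tensor Z) (X.tensor (Y.tensor Z)) (fun p => (p.1.1, p.1.2, p.2)) := by
  rintro i ⟨⟨b, c⟩, d⟩
  simp only [tensor]
  split_ifs <;> first | omega | (simp only [Option.map_map]; rfl)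

theorem CrystalData.Commutes.assoc_symm {n : ℕ} {B C D : Type} {X : CrystalData n B}
    {Y : CrystalData n C} {Z : CrystalData n D} :
    Commutes (X.tensor (Y.tensor Z)) ((X.tensor Y).tensor Z) (fun p => ((p.1, p.2.1), p.2.2)) := by
  rintro i ⟨b, c, d⟩
  simp only [tensor]
  split_ifs <;> first | omega | (simp only [Option.map_map]; rfl)

/-- A relation between two finite crystals of the same size that is total, injective and
compatible with all `f̃_i` is the graph of an isomorphism. -/
theorem exists_isCrystalIso_of_rel {n : ℕ} {B C : Type} [Finite B] {X : CrystalData n B}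
    {Y : CrystalData n C} (e : B ≃ C) (R : B → C → Prop) (htot : ∀ b, ∃ c, R b c)
    (hinj : ∀ b b' c, R b c → R b' c → b = b')
    (hf : ∀ i b c, R b c → (X.f i b = none ∧ Y.f i c = none) ∨
      ∃ b' c', X.f i b = some b' ∧ Y.f i c = some c' ∧ R b' c') :
    ∃ g : B → C, IsCrystalIso X Y g ∧ ∀ b c, R b c → g b = c := by
  choose g hg using htot
  have hi : Function.Injective g := fun b b' h => hinj b b' (g b) (hg b) (h ▸ hg b')
  have hs : Function.Surjective g := by
    have h1 : Function.Injective (e.symm ∘ g) := e.symm.injective.comp hi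
    have h2 := Finite.surjective_of_injective h1
    intro c
    obtain ⟨b, hb⟩ := h2 (e.symm c)
    exact ⟨b, e.symm.injective hb⟩
  have hR : ∀ b c, R b c → g b = c := by
    intro b c h
    obtain ⟨b', rfl⟩ := hs c
    rw [hinj b b' _ h (hg b')]
  refine ⟨g, ⟨⟨hi, hs⟩, fun i b => ?_⟩, hR⟩
  rcases hf i b (g b) (hg b) with ⟨h1, h2⟩ | ⟨b', c', h1, h2, h3⟩
  · rw [h1, h2]; rfl
  · rw [h1, h2, ← hR _ _ h3]; rfl

/-! ### Explicit rules for a row against a letter or a column -/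

/-- The multiplicity of `b` in the one-letter word `a`. -/
def unitVec {n : ℕ} (a b : Fin n) : ℕ := if b = a then 1 else 0

/-- Replace one `p` by `q` in a row. -/
def moveLetter {n : ℕ} (p q : Fin n) (x : Fin n → ℕ) (j : Fin n) : ℕ :=
  if j = p then x j - 1 else if j = q then x j + 1 else x j

/-- The graph of the isomorphism `x ⊗ a ↦ c ⊗ y` from `B_(k) ⊗ B_(1)` to `B_(1) ⊗ B_(k)`. -/
def RowLetterRel {n : ℕ} (x : Fin n → ℕ) (a c : Fin n) (y : Fin n → ℕ) : Prop :=
  (∀ j, x j + unitVec a j = y j + unitVec c j) ∧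
  ((a ≤ c ∧ (c = a ∨ 0 < x c) ∧ (∀ j, j < a → x j = 0) ∧ ∀ j, c < j → x j = 0) ∨
   (c < a ∧ 0 < x c ∧ ∀ j, c < j → j < a → x j = 0))

/-- The graph of the isomorphism `x ⊗ {a < b} ↦ {c < d} ⊗ y` from `B_(k) ⊗ B_(1,1)` to
`B_(1,1) ⊗ B_(k)`. -/
def RowColRel {n : ℕ} (x : Fin n → ℕ) (a b c d : Fin n) (y : Fin n → ℕ) : Prop :=
  (∀ j, x j + unitVec a j + unitVec b j = y j + unitVec c j + unitVec d j) ∧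
  ((a ≤ c ∧ c < b ∧ b ≤ d ∧ (c = a ∨ 0 < x c) ∧ (d = b ∨ 0 < x d) ∧ (∀ j, j < a → x j = 0) ∧
      (∀ j, c < j → j < b → x j = 0) ∧ ∀ j, d < j → x j = 0) ∨
   (c < a ∧ a ≤ d ∧ d < b ∧ 0 < x c ∧ (d = a ∨ 0 < x d) ∧ (∀ j, c < j → j < a → x j = 0) ∧
      ∀ j, d < j → j < b → x j = 0))

theorem exists_greatest {n : ℕ} (P : Fin n → Prop) (h : ∃ j, P j) :
    ∃ m, P m ∧ ∀ j, m < j → ¬ P j := by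
  classical
  obtain ⟨j, hj⟩ := h
  have hne : (Finset.univ.filter P).Nonempty := ⟨j, by simpa using hj⟩
  refine ⟨_, (Finset.mem_filter.1 (Finset.max'_mem _ hne)).2, fun i hi hP => ?_⟩
  exact absurd (Finset.le_max' _ i (by simpa using hP)) (not_le.2 hi)

/-- The letter `c` is the greatest letter of the row below `a`; if there is none, it is the greatest
letter among `a` and the row. Either way `c` occurs in `x` or equals `a`, so the truncated
subtraction defining `y` is exact. -/
theorem RowLetterRel.exists {n : ℕ} (x : Fin n → ℕ) (a : Fin n) :
    ∃ c y, RowLetterRel x a c y := by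
  by_cases h : ∃ j, j < a ∧ 0 < x j
  · obtain ⟨c, hc, hm⟩ := exists_greatest _ h
    refine ⟨c, fun j => x j + unitVec a j - unitVec c j, fun j => ?_, Or.inr ⟨hc.1, hc.2, ?_⟩⟩
    · simp only [unitVec]; grind
    · grind
  · obtain ⟨c, hc, hm⟩ := exists_greatest (fun j => a ≤ j ∧ (j = a ∨ 0 < x j)) ⟨a, by simp⟩
    refine ⟨c, fun j => x j + unitVec a j - unitVec c j, fun j => ?_,
      Or.inl ⟨hc.1, hc.2, ?_, ?_⟩⟩
    · simp only [unitVec]; grind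
    · grind
    · grind

/-- Search downwards in the row, cyclically: if some letter lies below `a`, the new entries come
from below `a` and from `[a, b)`; otherwise from `[a, b)` and from `b` upwards. Each search takes
the greatest letter available, with `a` or `b` itself as the default at the lower end of a range
containing it. -/
theorem RowColRel.exists {n : ℕ} (x : Fin n → ℕ) {a b : Fin n} (hab : a < b) :
    ∃ c d y, c < d ∧ RowColRel x a b c d y := by
  by_cases h : ∃ j, j < a ∧ 0 < x j
  · obtain ⟨c, hc, hm⟩ := exists_greatest _ h
    obtain ⟨d, hd, hm'⟩ := exists_greatest (fun j => a ≤ j ∧ j < b ∧ (j = a ∨ 0 < x j))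
      ⟨a, by simp [hab]⟩
    refine ⟨c, d, fun j => x j + unitVec a j + unitVec b j - unitVec c j - unitVec d j, ?_,
      fun j => ?_, Or.inr ⟨hc.1, hd.1, hd.2.1, hc.2, hd.2.2, ?_, ?_⟩⟩
    · order
    · simp only [unitVec]; grind
    · grind
    · grind
  · obtain ⟨c, hc, hm⟩ := exists_greatest (fun j => a ≤ j ∧ j < b ∧ (j = a ∨ 0 < x j))
      ⟨a, by simp [hab]⟩
    obtain ⟨d, hd, hm'⟩ := exists_greatest (fun j => b ≤ j ∧ (j = b ∨ 0 < x j)) ⟨b, by simp⟩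
    refine ⟨c, d, fun j => x j + unitVec a j + unitVec b j - unitVec c j - unitVec d j, ?_,
      fun j => ?_, Or.inl ⟨hc.1, hc.2.1, hd.1, hc.2.2, hd.2, ?_, ?_, ?_⟩⟩
    · order
    · simp only [unitVec]; grind
    · grind
    · grind
    · grind

/-- The rule is inverted by its mirror image: `a` is the smallest letter of `y` above `c`, or,
failing that, the smallest among `c` and the letters of `y`. Content preservation then gives `x`. -/
theorem RowLetterRel.injective {n : ℕ} {x x' : Fin n → ℕ} {a a' c : Fin n} {y : Fin n → ℕ}
    (h : RowLetterRel x a c y) (h' : RowLetterRel x' a' c y) : x = x' ∧ a = a' := by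
  obtain ⟨hs, h⟩ := h
  obtain ⟨hs', h'⟩ := h'
  have ha : a = a' := by
    simp only [unitVec] at *
    have h1 := hs a
    have h2 := hs a'
    have h3 := hs' a
    have h4 := hs' a'
    have h5 := hs c
    have h6 := hs' c
    grind
  subst ha
  refine ⟨funext fun j => ?_, rfl⟩
  have h1 := hs j
  have h2 := hs' j
  omega

/-- Again by the mirror rule: a letter of `y` above `d` distinguishes the two cases, and in each
range smallest letters replace greatest ones, with `c` or `d` as the default. -/
theorem RowColRel.injective {n : ℕ} {x x' : Fin n → ℕ} {a a' b b' c d : Fin n} {y : Fin n → ℕ}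
    (hab : a < b) (hab' : a' < b')
    (h : RowColRel x a b c d y) (h' : RowColRel x' a' b' c d y) : x = x' ∧ a = a' ∧ b = b' := by
  obtain ⟨hs, h⟩ := h
  obtain ⟨hs', h'⟩ := h'
  have ha : a = a' ∧ b = b' := by
    simp only [unitVec] at *
    have h1 := hs a
    have h2 := hs a'
    have h3 := hs' a
    have h4 := hs' a'
    have h5 := hs b
    have h6 := hs b'
    have h7 := hs' b
    have h8 := hs' b'
    have h9 := hs c
    have h10 := hs d
    have h11 := hs' c
    have h12 := hs' d
    rcases h with h | h <;> rcases h' with h' | h' <;> grind (splits := 30)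
  obtain ⟨rfl, rfl⟩ := ha
  refine ⟨funext fun j => ?_, rfl, rfl⟩
  have h1 := hs j
  have h2 := hs' j
  omega

/-- If `p`, `q` are consecutive letters, the operator for `p`, `q` maps `x ⊗ a` to `x' ⊗ a'`. -/
def RowLetterStep {n : ℕ} (p q : Fin n) (x : Fin n → ℕ) (a : Fin n) (x' : Fin n → ℕ)
    (a' : Fin n) : Prop :=
  (unitVec a q < x p ∧ x' = moveLetter p q x ∧ a' = a) ∨
  (x p ≤ unitVec a q ∧ a = p ∧ x' = x ∧ a' = q)

/-- If `p`, `q` are consecutive letters, the operator for `p`, `q` maps `c ⊗ y` to `c' ⊗ y'`. -/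
def LetterRowStep {n : ℕ} (p q : Fin n) (c : Fin n) (y : Fin n → ℕ) (c' : Fin n)
    (y' : Fin n → ℕ) : Prop :=
  (c = p ∧ y q = 0 ∧ c' = q ∧ y' = y) ∨
  (¬ (c = p ∧ y q = 0) ∧ 0 < y p ∧ c' = c ∧ y' = moveLetter p q y)

/-- Only the letters `p` and `q` change, and no letter lies strictly between them, so the order
conditions survive the move. The cases record which factor the tensor rule selects on each side;
those in which just one side vanishes are contradictory. -/
theorem RowLetterRel.step {n : ℕ} {p q : Fin n} (hpq : p < q) (hadj : ∀ j, p < j → q ≤ j)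
    {x : Fin n → ℕ} {a c : Fin n} {y : Fin n → ℕ} (h : RowLetterRel x a c y) :
    ((x p ≤ unitVec a q ∧ a ≠ p) ∧ ¬ (c = p ∧ y q = 0) ∧ y p = 0) ∨
    ∃ x' a' c' y', RowLetterStep p q x a x' a' ∧ LetterRowStep p q c y c' y' ∧
      RowLetterRel x' a' c' y' := by
  obtain ⟨hs, h⟩ := h
  have h1 := hs p
  have h2 := hs q
  have h3 := hs a
  have h4 := hs c
  have h5 := hadj a
  have h6 := hadj c
  by_cases hL : unitVec a q < x p
  · by_cases hR : c = p ∧ y q = 0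
    · refine Or.inr ⟨_, _, _, _, Or.inl ⟨hL, rfl, rfl⟩, Or.inl ⟨hR.1, hR.2, rfl, rfl⟩, ?_⟩
      refine ⟨fun j => ?_, ?_⟩
      · have := hs j
        simp only [unitVec, moveLetter] at *
        grind
      · simp only [unitVec, moveLetter] at *
        rcases h with h | h
        · refine Or.inl ⟨by grind, by grind, fun j => ?_, fun j => ?_⟩ <;>
          have := hadj j <;> grind (splits := 30)
        · refine Or.inr ⟨by grind, by grind, fun j => ?_⟩
          have := hadj j
          grind (splits := 30)
    · by_cases hR' : 0 < y p
      · refine Or.inr ⟨_, _, _, _, Or.inl ⟨hL, rfl, rfl⟩, Or.inr ⟨hR, hR', rfl, rfl⟩, ?_⟩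
        refine ⟨fun j => ?_, ?_⟩
        · have := hs j
          simp only [unitVec, moveLetter] at *
          grind
        · simp only [unitVec, moveLetter] at *
          rcases h with h | h
          · refine Or.inl ⟨by grind, by grind, fun j => ?_, fun j => ?_⟩ <;>
            have := hadj j <;> grind (splits := 30)
          · refine Or.inr ⟨by grind, by grind, fun j => ?_⟩
            have := hadj j
            grind (splits := 30)
      · exfalso
        simp only [unitVec] at *
        grind (splits := 30)
  · by_cases hL' : a = p
    · by_cases hR : c = p ∧ y q = 0
      · refine Or.inr ⟨_, _, _, _, Or.inr ⟨not_lt.1 hL, hL', rfl, rfl⟩,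
          Or.inl ⟨hR.1, hR.2, rfl, rfl⟩, ?_⟩
        refine ⟨fun j => ?_, ?_⟩
        · have := hs j
          simp only [unitVec] at *
          grind
        · simp only [unitVec] at *
          rcases h with h | h
          · refine Or.inl ⟨by grind, by grind, fun j => ?_, fun j => ?_⟩ <;>
            have := hadj j <;> grind (splits := 30)
          · refine Or.inr ⟨by grind, by grind, fun j => ?_⟩
            have := hadj j
            grind (splits := 30)
      · by_cases hR' : 0 < y p
        · refine Or.inr ⟨_, _, _, _, Or.inr ⟨not_lt.1 hL, hL', rfl, rfl⟩,
            Or.inr ⟨hR, hR', rfl, rfl⟩, ?_⟩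
          refine ⟨fun j => ?_, ?_⟩
          · have := hs j
            simp only [unitVec, moveLetter] at *
            grind
          · simp only [unitVec] at *
            rcases h with h | h
            · refine Or.inl ⟨by grind, by grind, fun j => ?_, fun j => ?_⟩ <;>
              have := hadj j <;> grind (splits := 30)
            · refine Or.inr ⟨by grind, by grind, fun j => ?_⟩
              have := hadj j
              grind (splits := 30)
        · exfalso
          simp only [unitVec] at *
          grind (splits := 30)
    · refine Or.inl ⟨⟨not_lt.1 hL, hL'⟩, ?_⟩
      simp only [unitVec] at *
      grind (splits := 30)

/-- The column `{a < b}` contains `p` but not `q`. -/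
def ColMovable {n : ℕ} (p q a b : Fin n) : Prop := (a = p ∨ b = p) ∧ a ≠ q ∧ b ≠ q

/-- If `p`, `q` are consecutive letters, the operator for `p`, `q` maps `x ⊗ {a < b}` to
`x' ⊗ {a' < b'}`. -/
def RowColStep {n : ℕ} (p q : Fin n) (x : Fin n → ℕ) (a b : Fin n) (x' : Fin n → ℕ)
    (a' b' : Fin n) : Prop :=
  ((1 < x p ∨ 0 < x p ∧ ¬ ColMovable q p a b) ∧ x' = moveLetter p q x ∧ a' = a ∧ b' = b) ∨
  (x p = 0 ∧ ColMovable p q a b ∧ x' = x ∧ a' = (if a = p then q else a) ∧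
    b' = if b = p then q else b)

/-- If `p`, `q` are consecutive letters, the operator for `p`, `q` maps `{c < d} ⊗ y` to
`{c' < d'} ⊗ y'`. -/
def ColRowStep {n : ℕ} (p q : Fin n) (c d : Fin n) (y : Fin n → ℕ) (c' d' : Fin n)
    (y' : Fin n → ℕ) : Prop :=
  ((ColMovable p q c d ∧ y q = 0) ∧ c' = (if c = p then q else c) ∧
    d' = (if d = p then q else d) ∧ y' = y) ∨
  (¬ (ColMovable p q c d ∧ y q = 0) ∧ 0 < y p ∧ c' = c ∧ d' = d ∧ y' = moveLetter p q y)

/-- The same comparison as for a letter. Since `ε_i` of a column is at most `1`, the rule acts on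
the row exactly when `x p > 1`, or `x p = 1` and that `ε_i` is `0`. -/
theorem RowColRel.step {n : ℕ} {p q : Fin n} (hpq : p < q) (hadj : ∀ j, p < j → q ≤ j)
    {x : Fin n → ℕ} {a b c d : Fin n} {y : Fin n → ℕ} (hab : a < b) (hcd : c < d)
    (h : RowColRel x a b c d y) :
    ((¬ (1 < x p ∨ 0 < x p ∧ ¬ ColMovable q p a b) ∧ ¬ ColMovable p q a b) ∧
      ¬ (ColMovable p q c d ∧ y q = 0) ∧ y p = 0) ∨
    ∃ x' a' b' c' d' y', RowColStep p q x a b x' a' b' ∧ ColRowStep p q c d y c' d' y' ∧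
      RowColRel x' a' b' c' d' y' := by
  obtain ⟨hs, h⟩ := h
  have h1 := hs p
  have h2 := hs q
  have h3 := hs a
  have h4 := hs c
  have h5 := hs b
  have h6 := hs d
  have h7 := hadj a
  have h8 := hadj b
  have h9 := hadj c
  have h10 := hadj d
  by_cases hL : 1 < x p ∨ 0 < x p ∧ ¬ ColMovable q p a b
  · by_cases hR : ColMovable p q c d ∧ y q = 0
    · refine Or.inr ⟨_, _, _, _, _, _, Or.inl ⟨hL, rfl, rfl, rfl⟩,
        Or.inl ⟨hR, rfl, rfl, rfl⟩, ?_⟩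
      refine ⟨fun j => ?_, ?_⟩
      · have := hs j
        simp only [unitVec, moveLetter, ColMovable] at *
        grind (splits := 30)
      · simp only [unitVec, moveLetter, ColMovable] at *
        rcases h with h | h
        · refine Or.inl ⟨?_, ?_, ?_, ?_, ?_, fun j => ?_, fun j => ?_, fun j => ?_⟩ <;>
            try have := hadj j
          all_goals grind (splits := 30)
        · refine Or.inr ⟨?_, ?_, ?_, ?_, ?_, fun j => ?_, fun j => ?_⟩ <;>
            try have := hadj j
          all_goals grind (splits := 30)
    · by_cases hR' : 0 < y p
      · refine Or.inr ⟨_, _, _, _, _, _, Or.inl ⟨hL, rfl, rfl, rfl⟩,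
          Or.inr ⟨hR, hR', rfl, rfl, rfl⟩, ?_⟩
        refine ⟨fun j => ?_, ?_⟩
        · have := hs j
          simp only [unitVec, moveLetter, ColMovable] at *
          grind (splits := 30)
        · simp only [unitVec, moveLetter, ColMovable] at *
          rcases h with h | h
          · refine Or.inl ⟨?_, ?_, ?_, ?_, ?_, fun j => ?_, fun j => ?_, fun j => ?_⟩ <;>
              try have := hadj j
            all_goals grind (splits := 30)
          · refine Or.inr ⟨?_, ?_, ?_, ?_, ?_, fun j => ?_, fun j => ?_⟩ <;>
              try have := hadj j
            all_goals grind (splits := 30)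
      · exfalso
        simp only [unitVec, ColMovable] at *
        grind (splits := 30)
  · by_cases hL' : ColMovable p q a b
    · have hx : x p = 0 := by
        simp only [ColMovable] at *
        grind
      by_cases hR : ColMovable p q c d ∧ y q = 0
      · refine Or.inr ⟨_, _, _, _, _, _, Or.inr ⟨hx, hL', rfl, rfl, rfl⟩,
          Or.inl ⟨hR, rfl, rfl, rfl⟩, ?_⟩
        refine ⟨fun j => ?_, ?_⟩
        · have := hs j
          simp only [unitVec, ColMovable] at *
          grind (splits := 30)
        · simp only [unitVec, ColMovable] at *
          rcases h with h | h
          · refine Or.inl ⟨?_, ?_, ?_, ?_, ?_, fun j => ?_, fun j => ?_, fun j => ?_⟩ <;>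
              try have := hadj j
            all_goals grind (splits := 30)
          · refine Or.inr ⟨?_, ?_, ?_, ?_, ?_, fun j => ?_, fun j => ?_⟩ <;>
              try have := hadj j
            all_goals grind (splits := 30)
      · by_cases hR' : 0 < y p
        · refine Or.inr ⟨_, _, _, _, _, _, Or.inr ⟨hx, hL', rfl, rfl, rfl⟩,
            Or.inr ⟨hR, hR', rfl, rfl, rfl⟩, ?_⟩
          refine ⟨fun j => ?_, ?_⟩
          · have := hs j
            simp only [unitVec, moveLetter, ColMovable] at *
            grind (splits := 30)
          · simp only [unitVec, ColMovable] at *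
            rcases h with h | h
            · refine Or.inl ⟨?_, ?_, ?_, ?_, ?_, fun j => ?_, fun j => ?_, fun j => ?_⟩ <;>
                try have := hadj j
              all_goals grind (splits := 30)
            · refine Or.inr ⟨?_, ?_, ?_, ?_, ?_, fun j => ?_, fun j => ?_⟩ <;>
                try have := hadj j
              all_goals grind (splits := 30)
        · exfalso
          simp only [unitVec, ColMovable] at *
          grind (splits := 30)
    · refine Or.inl ⟨⟨hL, hL'⟩, ?_⟩
      simp only [unitVec, ColMovable] at *
      grind (splits := 30)

/-! ### Rows and columns are regular crystals -/

theorem letter_lt_nextLetter {n : ℕ} (i : Fin (n - 1)) : letter i < nextLetter i := by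
  simp [letter, nextLetter, Fin.lt_def]

theorem nextLetter_le_of_letter_lt {n : ℕ} (i : Fin (n - 1)) (j : Fin n) (h : letter i < j) :
    nextLetter i ≤ j := by
  simp only [letter, nextLetter, Fin.lt_def, Fin.le_def] at *
  omega

theorem sum_unitVec {n : ℕ} (a : Fin n) : ∑ j, unitVec a j = 1 := by
  simp [unitVec]

theorem moveLetter_add_unitVec {n : ℕ} {p q : Fin n} (hpq : p ≠ q) {x : Fin n → ℕ} (h : 0 < x p)
    (j : Fin n) : moveLetter p q x j + unitVec p j = x j + unitVec q j := by
  simp only [moveLetter, unitVec]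
  grind

theorem sum_moveLetter {n : ℕ} {p q : Fin n} (hpq : p ≠ q) {x : Fin n → ℕ} (h : 0 < x p) :
    ∑ j, moveLetter p q x j = ∑ j, x j := by
  have hs := Finset.sum_congr (rfl : (Finset.univ : Finset (Fin n)) = Finset.univ)
    (fun j _ => moveLetter_add_unitVec hpq h j)
  rw [Finset.sum_add_distrib, Finset.sum_add_distrib, sum_unitVec, sum_unitVec] at hs
  omega

theorem rowCrystal_f_eq_some {n k : ℕ} (i : Fin (n - 1)) (x x' : RowTableau n k) :
    (rowCrystal n k).f i x = some x' ↔
      0 < x.1 (letter i) ∧ x'.1 = moveLetter (letter i) (nextLetter i) x.1 := by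
  simp only [rowCrystal]
  split_ifs with h
  · rw [Option.some_inj]
    exact ⟨fun e => ⟨h, e ▸ rfl⟩, fun e => Subtype.ext e.2.symm⟩
  · simp [h]

theorem ColTableau.ext {n : ℕ} {b b' : ColTableau n} (h : b.top = b'.top)
    (h' : b.bottom = b'.bottom) : b = b' := by
  obtain ⟨t, u, _⟩ := b
  obtain ⟨t', u', _⟩ := b'
  simp only at h h'
  subst h h'
  rfl

theorem ColTableau.movable_iff {n : ℕ} (b : ColTableau n) (p q : Fin n) :
    (b.Has p ∧ ¬ b.Has q) ↔ ColMovable p q b.top b.bottom := by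
  simp [ColTableau.Has, ColMovable, not_or]

theorem colCrystal_f_eq_some {n : ℕ} (i : Fin (n - 1)) (b b' : ColTableau n) :
    (colCrystal n).f i b = some b' ↔
      ColMovable (letter i) (nextLetter i) b.top b.bottom ∧
      b'.top = (if b.top = letter i then nextLetter i else b.top) ∧
      b'.bottom = (if b.bottom = letter i then nextLetter i else b.bottom) := by
  rw [← ColTableau.movable_iff]
  simp only [colCrystal]
  by_cases h : b.Has (letter i) ∧ ¬ b.Has (nextLetter i)
  · rw [dif_pos h, Option.some_inj]
    exact ⟨fun e => ⟨h, e ▸ rfl, e ▸ rfl⟩, fun e => ColTableau.ext e.2.1.symm e.2.2.symm⟩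
  · rw [dif_neg h]
    simp only [h, false_and, reduceCtorEq]

theorem rowCrystal_regular (n k : ℕ) : (rowCrystal n k).Regular where
  f_eq_none i x := by
    simp only [rowCrystal]
    split_ifs with h
    · simp only [false_iff]; omega
    · simp only [true_iff]; omega
  phi_f i x x' h := by
    obtain ⟨h1, h2⟩ := (rowCrystal_f_eq_some i x x').1 h
    simp only [rowCrystal, h2, moveLetter, if_true]
    omega
  eps_f i x x' h := by
    obtain ⟨h1, h2⟩ := (rowCrystal_f_eq_some i x x').1 h
    simp only [rowCrystal, h2, moveLetter, if_true, if_neg (letter_ne_nextLetter i).symm]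
  exists_f i x h := by
    have hne := letter_ne_nextLetter i
    refine ⟨⟨moveLetter (nextLetter i) (letter i) x.1, (sum_moveLetter hne.symm h).trans x.2⟩,
      (rowCrystal_f_eq_some i _ x).2 ⟨?_, funext fun j => ?_⟩⟩
    · simp [moveLetter, hne]
    · simp only [rowCrystal] at h
      simp only [moveLetter]
      grind
  exists_grade := by
    -- The grading is the sum of the letters, which `f̃_i` raises by one.
    refine ⟨fun x => ∑ j, x.1 j * j.1, fun i x x' h => ?_⟩
    obtain ⟨h1, h2⟩ := (rowCrystal_f_eq_some i x x').1 h
    have hs := Finset.sum_congr (rfl : (Finset.univ : Finset (Fin n)) = Finset.univ)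
      (fun j _ => congrArg (· * j.1) (moveLetter_add_unitVec (letter_ne_nextLetter i) h1 j))
    simp only [add_mul, Finset.sum_add_distrib] at hs
    have hu : ∀ a : Fin n, ∑ j, unitVec a j * j.1 = a.1 := fun a => by simp [unitVec]
    rw [hu, hu] at hs
    have := letter_lt_nextLetter i
    rw [Fin.lt_def] at this
    change ∑ j, x.1 j * j.1 < ∑ j, x'.1 j * j.1
    rw [h2]
    omega

instance {n : ℕ} (p q a b : Fin n) : Decidable (ColMovable p q a b) :=
  inferInstanceAs (Decidable (_ ∧ _))

theorem colCrystal_phi {n : ℕ} (i : Fin (n - 1)) (b : ColTableau n) :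
    (colCrystal n).phi i b =
      if ColMovable (letter i) (nextLetter i) b.top b.bottom then 1 else 0 :=
  if_congr (b.movable_iff _ _) rfl rfl

theorem colCrystal_eps {n : ℕ} (i : Fin (n - 1)) (b : ColTableau n) :
    (colCrystal n).eps i b =
      if ColMovable (nextLetter i) (letter i) b.top b.bottom then 1 else 0 :=
  if_congr (b.movable_iff _ _) rfl rfl

theorem colCrystal_regular (n : ℕ) : (colCrystal n).Regular where
  f_eq_none i x := by
    simp only [colCrystal]
    split_ifs with h <;> simp
  phi_f i b b' h := by
    obtain ⟨h1, h2, h3⟩ := (colCrystal_f_eq_some i b b').1 h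
    have hne := letter_ne_nextLetter i
    have hlt := b.lt
    have hlt' := b'.lt
    rw [colCrystal_phi, colCrystal_phi, if_pos h1, if_neg]
    simp only [ColMovable, h2, h3] at h1 ⊢
    grind
  eps_f i b b' h := by
    obtain ⟨h1, h2, h3⟩ := (colCrystal_f_eq_some i b b').1 h
    have hne := letter_ne_nextLetter i
    have hlt := b.lt
    have hlt' := b'.lt
    rw [colCrystal_eps, colCrystal_eps, if_pos, if_neg]
    · simp only [ColMovable] at h1 ⊢
      grind
    · simp only [ColMovable] at h1 ⊢
      grind
  exists_f i b h := by
    have hne := letter_lt_nextLetter i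
    have hadj := nextLetter_le_of_letter_lt i
    have hlt := b.lt
    rw [colCrystal_eps] at h
    have h' : ColMovable (nextLetter i) (letter i) b.top b.bottom := by
      by_contra hc
      simp [hc] at h
    simp only [ColMovable] at h'
    have := hadj b.top
    have := hadj b.bottom
    refine ⟨⟨if b.top = nextLetter i then letter i else b.top,
      if b.bottom = nextLetter i then letter i else b.bottom, ?_⟩,
      (colCrystal_f_eq_some i _ b).2 ⟨?_, ?_, ?_⟩⟩
    · grind
    · simp only [ColMovable]
      grind
    · grind
    · grind
  exists_grade := by
    refine ⟨fun b => b.top.1 + b.bottom.1, fun i b b' h => ?_⟩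
    obtain ⟨h1, h2, h3⟩ := (colCrystal_f_eq_some i b b').1 h
    have hne := letter_lt_nextLetter i
    have hlt := b.lt
    simp only [ColMovable] at h1
    simp only [h2, h3]
    grind

theorem tabCrystal_regular (n : ℕ) : ∀ s, (tabCrystal n s).Regular
  | .row k => rowCrystal_regular n k
  | .col => colCrystal_regular n

/-! ### Existence of the isomorphisms -/

instance {n k : ℕ} : Finite (RowTableau n k) := by
  refine Finite.of_injective
    (fun (x : RowTableau n k) (j : Fin n) => (⟨x.1 j, ?_⟩ : Fin (k + 1))) ?_
  · have := Finset.single_le_sum (f := x.1) (fun _ _ => Nat.zero_le _) (Finset.mem_univ j)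
    rw [x.2] at this
    omega
  · intro x x' h
    refine Subtype.ext (funext fun j => ?_)
    simpa using congrFun h j

instance {n : ℕ} : Finite (ColTableau n) :=
  Finite.of_injective (fun b : ColTableau n => (b.top, b.bottom)) fun b b' h => by
    simp only [Prod.mk.injEq] at h
    exact ColTableau.ext h.1 h.2

/-- The row with the single letter `a`. -/
def letterRow {n : ℕ} (a : Fin n) : RowTableau n 1 := ⟨unitVec a, sum_unitVec a⟩

theorem letterRow_injective {n : ℕ} : Function.Injective (letterRow (n := n)) := by
  intro a a' h
  have := congrFun (congrArg Subtype.val h) a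
  simp only [letterRow, unitVec] at this
  grind

theorem exists_letterRow {n : ℕ} (z : RowTableau n 1) : ∃ a, z = letterRow a := by
  have h : ∃ a, z.1 a ≠ 0 := by
    by_contra! h
    have := z.2
    simp [h] at this
  obtain ⟨a, ha⟩ := h
  refine ⟨a, Subtype.ext (funext fun j => ?_)⟩
  have h1 := Finset.add_sum_erase Finset.univ z.1 (Finset.mem_univ a)
  rw [z.2] at h1
  simp only [letterRow, unitVec]
  split_ifs with hj
  · subst hj; omega
  · have := Finset.single_le_sum (f := z.1) (s := Finset.univ.erase a) (fun _ _ => Nat.zero_le _)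
      (Finset.mem_erase.2 ⟨hj, Finset.mem_univ j⟩)
    omega

theorem exists_rowLetter_iso (n k : ℕ) :
    ∃ g, IsCrystalIso ((rowCrystal n k).tensor (rowCrystal n 1))
      ((rowCrystal n 1).tensor (rowCrystal n k)) g ∧
      ∀ x a c y, RowLetterRel x.1 a c y.1 → g (x, letterRow a) = (letterRow c, y) := by
  refine (exists_isCrystalIso_of_rel
    (X := (rowCrystal n k).tensor (rowCrystal n 1)) (Y := (rowCrystal n 1).tensor (rowCrystal n k))
    (Equiv.prodComm _ _)
    (fun u v => ∃ a c, u.2 = letterRow a ∧ v.1 = letterRow c ∧ RowLetterRel u.1.1 a c v.2.1)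
    ?_ ?_ ?_).imp fun g hg => ⟨hg.1, fun x a c y h => hg.2 _ _ ⟨a, c, rfl, rfl, h⟩⟩
  · rintro ⟨x, z⟩
    obtain ⟨a, rfl⟩ := exists_letterRow z
    obtain ⟨c, y, h⟩ := RowLetterRel.exists x.1 a
    refine ⟨(letterRow c, ⟨y, ?_⟩), a, c, rfl, rfl, h⟩
    have hs := Finset.sum_congr (rfl : (Finset.univ : Finset (Fin n)) = Finset.univ)
      (fun j _ => h.1 j)
    rw [Finset.sum_add_distrib, Finset.sum_add_distrib, sum_unitVec, sum_unitVec, x.2] at hs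
    omega
  · rintro ⟨x, z⟩ ⟨x', z'⟩ ⟨w, y⟩ ⟨a, c, h1, h2, h3⟩ ⟨a', c', h1', h2', h3'⟩
    simp only at *
    subst h1 h1' h2
    obtain rfl := letterRow_injective h2'
    obtain ⟨h4, rfl⟩ := h3.injective h3'
    rw [Subtype.ext h4]
  · rintro i ⟨x, z⟩ ⟨w, y⟩ ⟨a, c, h1, h2, h3⟩
    simp only at h1 h2 h3
    subst h1 h2
    have hne := letter_ne_nextLetter i
    rcases h3.step (letter_lt_nextLetter i) (nextLetter_le_of_letter_lt i) with
      ⟨⟨h4, h5⟩, h6, h7⟩ | ⟨x', a', c', y', hL, hR, h4⟩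
    · refine Or.inl ⟨?_, ?_⟩
      · rw [((rowCrystal_regular n k).tensor (rowCrystal_regular n 1)).f_eq_none]
        simp only [CrystalData.tensor, rowCrystal, letterRow, unitVec] at *
        grind
      · rw [((rowCrystal_regular n 1).tensor (rowCrystal_regular n k)).f_eq_none]
        simp only [CrystalData.tensor, rowCrystal, letterRow, unitVec] at *
        grind
    · have hsx : ∑ j, x' j = k := by
        rcases hL with ⟨hL, rfl, rfl⟩ | ⟨hL, rfl, rfl, rfl⟩
        · rw [sum_moveLetter hne (by omega), x.2]
        · exact x.2
      have hsy : ∑ j, y' j = k := by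
        rcases hR with ⟨hR, hR', rfl, rfl⟩ | ⟨hR, hR', rfl, rfl⟩
        · exact y.2
        · rw [sum_moveLetter hne hR', y.2]
      have hmove : moveLetter (letter i) (nextLetter i) (unitVec (letter i)) =
          unitVec (nextLetter i) := by
        funext j
        simp only [moveLetter, unitVec]
        grind
      refine Or.inr ⟨(⟨x', hsx⟩, letterRow a'), (letterRow c', ⟨y', hsy⟩), ?_, ?_,
        a', c', rfl, rfl, h4⟩
      · rw [tensor_f_eq_some]
        rcases hL with ⟨hL, rfl, rfl⟩ | ⟨hL, rfl, rfl, rfl⟩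
        · exact Or.inl ⟨hL, (rowCrystal_f_eq_some _ _ _).2 ⟨Nat.zero_lt_of_lt hL, rfl⟩, rfl⟩
        · refine Or.inr ⟨hL, rfl, (rowCrystal_f_eq_some _ _ _).2 ⟨?_, hmove.symm⟩⟩
          simp [letterRow, unitVec]
      · rw [tensor_f_eq_some]
        rcases hR with ⟨rfl, hR', rfl, rfl⟩ | ⟨hR, hR', rfl, rfl⟩
        · refine Or.inl ⟨?_, (rowCrystal_f_eq_some _ _ _).2 ⟨?_, hmove.symm⟩, rfl⟩
          · simpa [rowCrystal, letterRow, unitVec] using hR'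
          · simp [letterRow, unitVec]
        · refine Or.inr ⟨?_, rfl, (rowCrystal_f_eq_some _ _ _).2 ⟨hR', rfl⟩⟩
          simp only [rowCrystal, letterRow, unitVec]
          grind

theorem exists_rowCol_iso (n k : ℕ) :
    ∃ g, IsCrystalIso ((rowCrystal n k).tensor (colCrystal n))
      ((colCrystal n).tensor (rowCrystal n k)) g ∧
      ∀ x b d y, RowColRel x.1 b.top b.bottom d.top d.bottom y.1 → g (x, b) = (d, y) := by
  refine (exists_isCrystalIso_of_rel
    (X := (rowCrystal n k).tensor (colCrystal n)) (Y := (colCrystal n).tensor (rowCrystal n k))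
    (Equiv.prodComm _ _)
    (fun u v => RowColRel u.1.1 u.2.top u.2.bottom v.1.top v.1.bottom v.2.1)
    ?_ ?_ ?_).imp fun g hg => ⟨hg.1, fun x b d y h => hg.2 _ _ h⟩
  · rintro ⟨x, b⟩
    obtain ⟨c, d, y, hcd, h⟩ := RowColRel.exists x.1 b.lt
    refine ⟨(⟨c, d, hcd⟩, ⟨y, ?_⟩), h⟩
    have hs := Finset.sum_congr (rfl : (Finset.univ : Finset (Fin n)) = Finset.univ)
      (fun j _ => h.1 j)
    simp only [Finset.sum_add_distrib, sum_unitVec, x.2] at hs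
    omega
  · rintro ⟨x, b⟩ ⟨x', b'⟩ ⟨d, y⟩ h h'
    simp only at h h'
    obtain ⟨h1, h2, h3⟩ := h.injective b.lt b'.lt h'
    rw [Subtype.ext h1, ColTableau.ext h2 h3]
  · rintro i ⟨x, b⟩ ⟨d, y⟩ h
    simp only at h
    have hne := letter_ne_nextLetter i
    have hlt := letter_lt_nextLetter i
    have hadj := nextLetter_le_of_letter_lt i
    rcases h.step hlt hadj b.lt d.lt with
      ⟨⟨h4, h5⟩, h6, h7⟩ | ⟨x', a', b', c', d', y', hL, hR, h4⟩
    · refine Or.inl ⟨?_, ?_⟩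
      · rw [((rowCrystal_regular n k).tensor (colCrystal_regular n)).f_eq_none]
        simp only [CrystalData.tensor, rowCrystal, colCrystal, ColTableau.movable_iff]
        split_ifs <;> grind
      · rw [((colCrystal_regular n).tensor (rowCrystal_regular n k)).f_eq_none]
        simp only [CrystalData.tensor, rowCrystal, colCrystal, ColTableau.movable_iff]
        split_ifs <;> grind
    · have hsx : ∑ j, x' j = k := by
        rcases hL with ⟨hL, rfl, rfl, rfl⟩ | ⟨hL, hL', rfl, rfl, rfl⟩
        · rw [sum_moveLetter hne (by omega), x.2]
        · exact x.2
      have hsy : ∑ j, y' j = k := by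
        rcases hR with ⟨hR, rfl, rfl, rfl⟩ | ⟨hR, hR', rfl, rfl, rfl⟩
        · exact y.2
        · rw [sum_moveLetter hne hR', y.2]
      have hab' : a' < b' := by
        have := b.lt
        rcases hL with ⟨hL, rfl, rfl, rfl⟩ | ⟨hL, hL', rfl, rfl, rfl⟩
        · exact this
        · simp only [ColMovable] at hL'
          have := hadj b.bottom
          grind
      have hcd' : c' < d' := by
        have := d.lt
        rcases hR with ⟨hR, rfl, rfl, rfl⟩ | ⟨hR, hR', rfl, rfl, rfl⟩
        · simp only [ColMovable] at hR
          have := hadj d.bottom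
          grind
        · exact this
      refine Or.inr ⟨(⟨x', hsx⟩, ⟨a', b', hab'⟩), (⟨c', d', hcd'⟩, ⟨y', hsy⟩), ?_, ?_, h4⟩
      · rw [tensor_f_eq_some]
        rcases hL with ⟨hL, rfl, rfl, rfl⟩ | ⟨hL, hL', rfl, rfl, rfl⟩
        · refine Or.inl ⟨?_, (rowCrystal_f_eq_some _ _ _).2
            ⟨hL.elim Nat.zero_lt_of_lt And.left, rfl⟩, rfl⟩
          simp only [rowCrystal, colCrystal, ColTableau.movable_iff]
          split_ifs <;> grind
        · refine Or.inr ⟨?_, rfl, (colCrystal_f_eq_some _ _ _).2 ⟨hL', rfl, rfl⟩⟩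
          exact hL.trans_le (Nat.zero_le _)
      · rw [tensor_f_eq_some]
        rcases hR with ⟨hR, rfl, rfl, rfl⟩ | ⟨hR, hR', rfl, rfl, rfl⟩
        · refine Or.inl ⟨?_, (colCrystal_f_eq_some _ _ _).2 ⟨hR.1, rfl, rfl⟩, rfl⟩
          simp only [rowCrystal, colCrystal_phi, if_pos hR.1, hR.2, Nat.zero_lt_one]
        · refine Or.inr ⟨?_, rfl, (rowCrystal_f_eq_some _ _ _).2 ⟨hR', rfl⟩⟩
          simp only [rowCrystal, colCrystal, ColTableau.movable_iff]
          split_ifs <;> grind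

/-! ### Highest elements of two-fold products and uniqueness -/

theorem CrystalData.tensor_eps_eq_zero {n : ℕ} {B C : Type} {X : CrystalData n B}
    {Y : CrystalData n C} (i : Fin (n - 1)) (p : B × C) :
    (X.tensor Y).eps i p = 0 ↔ X.eps i p.1 = 0 ∧ Y.eps i p.2 ≤ X.phi i p.1 := by
  simp only [tensor]
  omega

theorem colMovable_letter_iff {n : ℕ} (i : Fin (n - 1)) (a b : Fin n) :
    ColMovable (letter i) (nextLetter i) a b ↔
      (a.1 = i.1 ∨ b.1 = i.1) ∧ a.1 ≠ i.1 + 1 ∧ b.1 ≠ i.1 + 1 := by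
  simp [ColMovable, letter, nextLetter, Fin.ext_iff]

theorem colMovable_nextLetter_iff {n : ℕ} (i : Fin (n - 1)) (a b : Fin n) :
    ColMovable (nextLetter i) (letter i) a b ↔
      (a.1 = i.1 + 1 ∨ b.1 = i.1 + 1) ∧ a.1 ≠ i.1 ∧ b.1 ≠ i.1 := by
  simp [ColMovable, letter, nextLetter, Fin.ext_iff]

theorem rowCrystal_eps {n k : ℕ} (x : RowTableau n k) (j : ℕ) (hj : j + 1 < n) :
    (rowCrystal n k).eps ⟨j, by omega⟩ x = x.1 ⟨j + 1, hj⟩ := rfl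

theorem rowCrystal_phi {n k : ℕ} (x : RowTableau n k) (j : ℕ) (hj : j + 1 < n) :
    (rowCrystal n k).phi ⟨j, by omega⟩ x = x.1 ⟨j, by omega⟩ := rfl

theorem colCrystal_eps_mk {n : ℕ} (b : ColTableau n) (j : ℕ) (hj : j + 1 < n) :
    (colCrystal n).eps ⟨j, by omega⟩ b =
      if (b.top.1 = j + 1 ∨ b.bottom.1 = j + 1) ∧ b.top.1 ≠ j ∧ b.bottom.1 ≠ j then 1 else 0 := by
  rw [colCrystal_eps]
  simp only [colMovable_nextLetter_iff]

theorem colCrystal_phi_mk {n : ℕ} (b : ColTableau n) (j : ℕ) (hj : j + 1 < n) :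
    (colCrystal n).phi ⟨j, by omega⟩ b =
      if (b.top.1 = j ∨ b.bottom.1 = j) ∧ b.top.1 ≠ j + 1 ∧ b.bottom.1 ≠ j + 1 then 1 else 0 := by
  rw [colCrystal_phi]
  simp only [colMovable_letter_iff]

theorem row_highest {n k : ℕ} {x : RowTableau n k} (h : ∀ i, (rowCrystal n k).eps i x = 0)
    (j : ℕ) (hj : j + 1 < n) : x.1 ⟨j + 1, hj⟩ = 0 :=
  h ⟨j, by omega⟩

theorem row_highest_zero {n k : ℕ} (hn : 2 ≤ n) {x : RowTableau n k}
    (h : ∀ i, (rowCrystal n k).eps i x = 0) : x.1 ⟨0, by omega⟩ = k := by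
  refine (Fintype.sum_eq_single (⟨0, by omega⟩ : Fin n) ?_).symm.trans x.2
  rintro ⟨j, hj⟩ hne
  obtain ⟨j, rfl⟩ := Nat.exists_eq_succ_of_ne_zero (fun h => hne (Fin.ext h))
  exact row_highest h j hj

theorem row_highest_eq {n k : ℕ} (hn : 2 ≤ n) {x : RowTableau n k}
    (h : ∀ i, (rowCrystal n k).eps i x = 0) (j : Fin n) :
    x.1 j = if j.1 = 0 then k else 0 := by
  obtain ⟨j, hj⟩ := j
  cases j with
  | zero => simpa using row_highest_zero hn h
  | succ j => simpa using row_highest h j hj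

theorem col_highest {n : ℕ} {b : ColTableau n} (h : ∀ i, (colCrystal n).eps i b = 0) :
    b.top.1 = 0 ∧ b.bottom.1 = 1 := by
  have hlt : b.top.1 < b.bottom.1 := b.lt
  have hb := b.bottom.2
  have h' : ∀ j, j + 1 < n →
      ¬ ((b.top.1 = j + 1 ∨ b.bottom.1 = j + 1) ∧ b.top.1 ≠ j ∧ b.bottom.1 ≠ j) := by
    intro j hj hc
    have := h ⟨j, by omega⟩
    rw [colCrystal_eps_mk b j hj, if_pos hc] at this
    omega
  -- These are the indices at which an entry of the column could have `ε = 1`; if the top entry is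
  -- already the first letter, the truncated index is harmless.
  have h1 := h' (b.top.1 - 1)
  have h2 := h' (b.bottom.1 - 1)
  omega

/-- The highest elements are `1^k ⊗ 1^(m-r) 2^r` with `r ≤ k`, where `φ_1 = k + m - 2r` determines
`r`. -/
theorem row_tensor_row_highest_unique {n k m : ℕ} (hn : 2 ≤ n)
    (c c' : RowTableau n k × RowTableau n m)
    (h : ∀ i, ((rowCrystal n k).tensor (rowCrystal n m)).eps i c = 0)
    (h' : ∀ i, ((rowCrystal n k).tensor (rowCrystal n m)).eps i c' = 0)
    (he : ∀ i, ((rowCrystal n k).tensor (rowCrystal n m)).phi i c =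
      ((rowCrystal n k).tensor (rowCrystal n m)).phi i c') : c = c' := by
  have key : ∀ c : RowTableau n k × RowTableau n m,
      (∀ i, ((rowCrystal n k).tensor (rowCrystal n m)).eps i c = 0) →
      (∀ j : Fin n, c.1.1 j = if j.1 = 0 then k else 0) ∧ (∀ j : Fin n, 2 ≤ j.1 → c.2.1 j = 0) ∧
      c.2.1 ⟨0, by omega⟩ + c.2.1 ⟨1, by omega⟩ = m ∧ c.2.1 ⟨1, by omega⟩ ≤ k := by
    intro c h
    simp only [tensor_eps_eq_zero] at h
    have h1 := row_highest_eq hn (fun i => (h i).1)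
    have h2 : ∀ j : Fin n, 2 ≤ j.1 → c.2.1 j = 0 := by
      rintro ⟨j, hj⟩ hj2
      obtain ⟨j, rfl⟩ : ∃ i, j = i + 1 := ⟨j - 1, by simp only at hj2; omega⟩
      have := (h ⟨j, by omega⟩).2
      rw [rowCrystal_eps _ _ hj, rowCrystal_phi _ _ hj, h1, if_neg] at this
      · omega
      · simp only at hj2 ⊢; omega
    refine ⟨h1, h2, ?_, ?_⟩
    · rw [← Fintype.sum_eq_add (⟨0, by omega⟩ : Fin n) ⟨1, by omega⟩ (by simp), c.2.2]
      rintro j ⟨hj, hj'⟩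
      refine h2 j ?_
      simp only [ne_eq, Fin.ext_iff] at hj hj'
      omega
    · have := (h ⟨0, by omega⟩).2
      rw [rowCrystal_eps _ _ (by omega), rowCrystal_phi _ _ (by omega), h1] at this
      simpa using this
  obtain ⟨h1, h2, h3, h4⟩ := key c h
  obtain ⟨h1', h2', h3', h4'⟩ := key c' h'
  have he0 := he ⟨0, by omega⟩
  simp only [tensor, rowCrystal_eps _ _ hn, rowCrystal_phi _ _ hn] at he0
  simp only [h1, h1', if_true, zero_add] at he0
  refine Prod.ext (Subtype.ext (funext fun j => by rw [h1, h1']))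
    (Subtype.ext (funext fun j => ?_))
  obtain ⟨j, hj⟩ := j
  match j with
  | 0 => omega
  | 1 => omega
  | j + 2 => rw [h2 _ (by simp), h2' _ (by simp)]

/-- The candidates are `1^k ⊗ {1,2}` and, for `k ≥ 1`, `1^k ⊗ {2,3}`; their `φ_1` are `k` and `k -
1`. -/
theorem row_tensor_col_highest_unique {n k : ℕ} (hn : 2 ≤ n)
    (c c' : RowTableau n k × ColTableau n)
    (h : ∀ i, ((rowCrystal n k).tensor (colCrystal n)).eps i c = 0)
    (h' : ∀ i, ((rowCrystal n k).tensor (colCrystal n)).eps i c' = 0)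
    (he : ∀ i, ((rowCrystal n k).tensor (colCrystal n)).phi i c =
      ((rowCrystal n k).tensor (colCrystal n)).phi i c') : c = c' := by
  have key : ∀ c : RowTableau n k × ColTableau n,
      (∀ i, ((rowCrystal n k).tensor (colCrystal n)).eps i c = 0) →
      (∀ j : Fin n, c.1.1 j = if j.1 = 0 then k else 0) ∧
      ((c.2.top.1 = 0 ∧ c.2.bottom.1 = 1) ∨ (c.2.top.1 = 1 ∧ c.2.bottom.1 = 2 ∧ 1 ≤ k)) := by
    intro c h
    simp only [tensor_eps_eq_zero] at h
    have h1 := row_highest_eq hn (fun i => (h i).1)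
    have h2 : ∀ j, j + 1 < n →
        (if (c.2.top.1 = j + 1 ∨ c.2.bottom.1 = j + 1) ∧ c.2.top.1 ≠ j ∧ c.2.bottom.1 ≠ j
          then 1 else 0) ≤ if j = 0 then k else 0 := by
      intro j hj
      have := (h ⟨j, by omega⟩).2
      rwa [colCrystal_eps_mk _ _ hj, rowCrystal_phi _ _ hj, h1] at this
    have hlt : c.2.top.1 < c.2.bottom.1 := c.2.lt
    have hb := c.2.bottom.2
    have h3 := h2 (c.2.top.1 - 1)
    have h4 := h2 (c.2.bottom.1 - 1)
    refine ⟨h1, ?_⟩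
    grind
  obtain ⟨h1, h2⟩ := key c h
  obtain ⟨h1', h2'⟩ := key c' h'
  have he0 := he ⟨0, by omega⟩
  simp only [tensor, rowCrystal_phi _ _ hn, colCrystal_phi_mk _ _ hn, colCrystal_eps_mk _ _ hn]
    at he0
  simp only [h1, h1', if_true, zero_add] at he0
  have : c.2.top.1 = c'.2.top.1 ∧ c.2.bottom.1 = c'.2.bottom.1 := by
    rcases h2 with ⟨h2, h3⟩ | ⟨h2, h3, h4⟩ <;> rcases h2' with ⟨h2', h3'⟩ | ⟨h2', h3', h4'⟩ <;>
      simp [h2, h3, h2', h3'] at he0 ⊢ <;> omega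
  exact Prod.ext (Subtype.ext (funext fun j => by rw [h1, h1']))
    (ColTableau.ext (Fin.ext this.1) (Fin.ext this.2))

/-- The highest elements are `{1,2} ⊗ 1^(k-r) 3^r`, and `φ_1 = k - r`. For `n = 2` only `r = 0`
occurs. -/
theorem col_tensor_row_highest_unique {n k : ℕ} (hn : 2 ≤ n)
    (c c' : ColTableau n × RowTableau n k)
    (h : ∀ i, ((colCrystal n).tensor (rowCrystal n k)).eps i c = 0)
    (h' : ∀ i, ((colCrystal n).tensor (rowCrystal n k)).eps i c' = 0)
    (he : ∀ i, ((colCrystal n).tensor (rowCrystal n k)).phi i c =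
      ((colCrystal n).tensor (rowCrystal n k)).phi i c') : c = c' := by
  have key : ∀ c : ColTableau n × RowTableau n k,
      (∀ i, ((colCrystal n).tensor (rowCrystal n k)).eps i c = 0) →
      c.1.top.1 = 0 ∧ c.1.bottom.1 = 1 ∧ (∀ j : Fin n, j.1 ≠ 0 → j.1 ≠ 2 → c.2.1 j = 0) ∧
      ∀ hn : 2 < n, c.2.1 ⟨0, by omega⟩ + c.2.1 ⟨2, hn⟩ = k := by
    intro c h
    simp only [tensor_eps_eq_zero] at h
    obtain ⟨h1, h2⟩ := col_highest (fun i => (h i).1)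
    have h3 : ∀ j : Fin n, j.1 ≠ 0 → j.1 ≠ 2 → c.2.1 j = 0 := by
      rintro ⟨j, hj⟩ hj0 hj2
      simp only at hj0 hj2
      obtain ⟨j, rfl⟩ : ∃ i, j = i + 1 := ⟨j - 1, by omega⟩
      have := (h ⟨j, by omega⟩).2
      rw [rowCrystal_eps _ _ hj, colCrystal_phi_mk _ _ hj, if_neg] at this
      · omega
      · omega
    refine ⟨h1, h2, h3, fun hn => ?_⟩
    rw [← Fintype.sum_eq_add (⟨0, by omega⟩ : Fin n) ⟨2, by omega⟩ (by simp), c.2.2]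
    rintro j ⟨hj, hj'⟩
    exact h3 j (fun e => hj (Fin.ext e)) (fun e => hj' (Fin.ext e))
  obtain ⟨h1, h2, h3, h4⟩ := key c h
  obtain ⟨h1', h2', h3', h4'⟩ := key c' h'
  have he0 := he ⟨0, by omega⟩
  simp only [tensor, rowCrystal_eps _ _ hn, rowCrystal_phi _ _ hn, colCrystal_phi_mk _ _ hn]
    at he0
  simp [h1, h1', h2, h2'] at he0
  refine Prod.ext (ColTableau.ext (Fin.ext (h1.trans h1'.symm)) (Fin.ext (h2.trans h2'.symm)))
    (Subtype.ext (funext fun j => ?_))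
  obtain ⟨j, hj⟩ := j
  by_cases hj0 : j = 0
  · subst hj0; exact he0
  · by_cases hj2 : j = 2
    · subst hj2
      have := h4 hj
      have := h4' hj
      omega
    · rw [h3 _ hj0 hj2, h3' _ hj0 hj2]

/-- After `{1,2}` the second column is `{1,2}`, `{1,3}` or `{3,4}`, with `(φ_1, φ_2)` equal to
`(0,2)`, `(1,0)`, `(0,0)`. For `n = 2`, where `φ_2` is absent, only the first fits. -/
theorem col_tensor_col_highest_unique {n : ℕ} (hn : 2 ≤ n) (c c' : ColTableau n × ColTableau n)
    (h : ∀ i, ((colCrystal n).tensor (colCrystal n)).eps i c = 0)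
    (h' : ∀ i, ((colCrystal n).tensor (colCrystal n)).eps i c' = 0)
    (he : ∀ i, ((colCrystal n).tensor (colCrystal n)).phi i c =
      ((colCrystal n).tensor (colCrystal n)).phi i c') : c = c' := by
  have key : ∀ c : ColTableau n × ColTableau n,
      (∀ i, ((colCrystal n).tensor (colCrystal n)).eps i c = 0) →
      c.1.top.1 = 0 ∧ c.1.bottom.1 = 1 ∧ ((c.2.top.1 = 0 ∧ c.2.bottom.1 = 1) ∨
        (c.2.top.1 = 0 ∧ c.2.bottom.1 = 2) ∨ (c.2.top.1 = 2 ∧ c.2.bottom.1 = 3)) := by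
    intro c h
    simp only [tensor_eps_eq_zero] at h
    obtain ⟨h1, h2⟩ := col_highest (fun i => (h i).1)
    have h3 : ∀ j, j + 1 < n →
        (if (c.2.top.1 = j + 1 ∨ c.2.bottom.1 = j + 1) ∧ c.2.top.1 ≠ j ∧ c.2.bottom.1 ≠ j
          then 1 else 0) ≤ if j = 1 then 1 else 0 := by
      intro j hj
      have := (h ⟨j, by omega⟩).2
      rw [colCrystal_eps_mk _ _ hj, colCrystal_phi_mk _ _ hj, h1, h2] at this
      refine this.trans ?_
      split_ifs <;> omega
    have hlt : c.2.top.1 < c.2.bottom.1 := c.2.lt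
    have hb := c.2.bottom.2
    have h4 := h3 (c.2.top.1 - 1)
    have h5 := h3 (c.2.bottom.1 - 1)
    refine ⟨h1, h2, ?_⟩
    grind
  obtain ⟨h1, h2, h3⟩ := key c h
  obtain ⟨h1', h2', h3'⟩ := key c' h'
  have he0 := he ⟨0, by omega⟩
  simp only [tensor, colCrystal_eps_mk _ _ hn, colCrystal_phi_mk _ _ hn] at he0
  have he1 := fun hn3 : 1 + 1 < n => he ⟨1, by omega⟩
  have hb := c.2.bottom.2
  have hb' := c'.2.bottom.2
  have : c.2.top.1 = c'.2.top.1 ∧ c.2.bottom.1 = c'.2.bottom.1 := by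
    by_cases hn3 : 1 + 1 < n
    · have he1 := he1 hn3
      simp only [tensor, colCrystal_eps_mk _ _ hn3, colCrystal_phi_mk _ _ hn3] at he1
      rcases h3 with ⟨h3, h4⟩ | ⟨h3, h4⟩ | ⟨h3, h4⟩ <;>
        rcases h3' with ⟨h3', h4'⟩ | ⟨h3', h4'⟩ | ⟨h3', h4'⟩ <;>
          simp [h1, h2, h1', h2', h3, h4, h3', h4'] at he0 he1 ⊢
    · omega
  exact Prod.ext (ColTableau.ext (Fin.ext (h1.trans h1'.symm)) (Fin.ext (h2.trans h2'.symm)))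
    (ColTableau.ext (Fin.ext this.1) (Fin.ext this.2))

theorem tensorIso_unique {n : ℕ} (hn : 2 ≤ n) (s t : CrystalShape)
    {g g' : Tab n s × Tab n t → Tab n t × Tab n s} (hg : IsTensorIso n s t g)
    (hg' : IsTensorIso n s t g') : g = g' := by
  refine IsCrystalIso.unique ((tabCrystal_regular n s).tensor (tabCrystal_regular n t))
    ((tabCrystal_regular n t).tensor (tabCrystal_regular n s)) ?_ hg hg'
  cases t with
  | row k =>
    cases s with
    | row m => exact row_tensor_row_highest_unique hn
    | col => exact row_tensor_col_highest_unique hn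
  | col =>
    cases s with
    | row m => exact col_tensor_row_highest_unique hn
    | col => exact col_tensor_col_highest_unique hn

/-! ### The map `σ`: involutivity and explicit values -/

theorem RowLetterRel.sum_eq {n : ℕ} {x : Fin n → ℕ} {a c : Fin n} {y : Fin n → ℕ}
    (h : RowLetterRel x a c y) : ∑ j, y j = ∑ j, x j := by
  have hs := Finset.sum_congr (rfl : (Finset.univ : Finset (Fin n)) = Finset.univ)
    (fun j _ => h.1 j)
  simp only [Finset.sum_add_distrib, sum_unitVec] at hs
  omega

theorem RowColRel.sum_eq {n : ℕ} {x : Fin n → ℕ} {a b c d : Fin n} {y : Fin n → ℕ}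
    (h : RowColRel x a b c d y) : ∑ j, y j = ∑ j, x j := by
  have hs := Finset.sum_congr (rfl : (Finset.univ : Finset (Fin n)) = Finset.univ)
    (fun j _ => h.1 j)
  simp only [Finset.sum_add_distrib, sum_unitVec] at hs
  omega

theorem combR_spec {n : ℕ} {s t : CrystalShape} (h : ∃ g, IsTensorIso n s t g) :
    IsTensorIso n s t (combR n s t) :=
  Classical.epsilon_spec h

theorem exists_tensorIso_symm {n : ℕ} {s t : CrystalShape} (h : ∃ g, IsTensorIso n s t g) :
    ∃ g, IsTensorIso n t s g := by
  obtain ⟨g, hg⟩ := h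
  exact ⟨Function.surjInv hg.1.2, hg.of_inverse (Function.rightInverse_surjInv hg.1.2)⟩

theorem exists_tensorIso_row (n k : ℕ) : ∃ g, IsTensorIso n (.row k) (.row 1) g :=
  (exists_rowLetter_iso n k).imp fun _ h => h.1

theorem exists_tensorIso_col (n k : ℕ) : ∃ g, IsTensorIso n (.row k) .col g :=
  (exists_rowCol_iso n k).imp fun _ h => h.1

theorem exists_tensorIso {n l : ℕ} {s t : CrystalShape} (hs : s ∈ basicShapes l)
    (ht : t ∈ basicShapes l) : ∃ g, IsTensorIso n s t g := by
  rcases hs with rfl | rfl | rfl <;> rcases ht with rfl | rfl | rfl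
  · exact ⟨id, IsCrystalIso.id _⟩
  · exact exists_tensorIso_row n l
  · exact exists_tensorIso_col n l
  · exact exists_tensorIso_symm (exists_tensorIso_row n l)
  · exact ⟨id, IsCrystalIso.id _⟩
  · exact exists_tensorIso_col n 1
  · exact exists_tensorIso_symm (exists_tensorIso_col n l)
  · exact exists_tensorIso_symm (exists_tensorIso_col n 1)
  · exact ⟨id, IsCrystalIso.id _⟩

theorem combR_self {n : ℕ} (hn : 2 ≤ n) (s : CrystalShape) : combR n s s = id :=
  tensorIso_unique hn s s (combR_spec ⟨id, IsCrystalIso.id _⟩) (IsCrystalIso.id _)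

theorem combR_combR {n : ℕ} (hn : 2 ≤ n) {s t : CrystalShape} (h : ∃ g, IsTensorIso n s t g)
    (p : Tab n s × Tab n t) : combR n t s (combR n s t p) = p := by
  obtain ⟨g, hg⟩ := exists_tensorIso_symm h
  have h1 : IsCrystalIso _ _ (combR n t s ∘ combR n s t) :=
    (combR_spec ⟨g, hg⟩).comp (combR_spec h)
  -- Composing once more with `σ` gives another isomorphism `B_s ⊗ B_t → B_t ⊗ B_s`, to which
  -- uniqueness applies; injectivity of `σ` then cancels the extra factor.
  have h2 : combR n s t ∘ combR n t s ∘ combR n s t = combR n s t :=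
    tensorIso_unique hn s t ((combR_spec h).comp h1) (combR_spec h)
  exact (combR_spec h).1.1 (congrFun h2 p)

theorem combR_row_letterRow {n k : ℕ} (hn : 2 ≤ n) {x : RowTableau n k} {a c : Fin n}
    {y : Fin n → ℕ} (h : RowLetterRel x.1 a c y) :
    combR n (.row k) (.row 1) (x, letterRow a) = (letterRow c, ⟨y, h.sum_eq.trans x.2⟩) := by
  obtain ⟨g, hg, hR⟩ := exists_rowLetter_iso n k
  have hg : IsTensorIso n (.row k) (.row 1) g := hg
  rw [tensorIso_unique hn _ _ (combR_spec ⟨g, hg⟩) hg]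
  exact hR x a c ⟨y, h.sum_eq.trans x.2⟩ h

theorem combR_row_col {n k : ℕ} (hn : 2 ≤ n) {x : RowTableau n k} {b d : ColTableau n}
    {y : Fin n → ℕ} (h : RowColRel x.1 b.top b.bottom d.top d.bottom y) :
    combR n (.row k) .col (x, b) = (d, ⟨y, h.sum_eq.trans x.2⟩) := by
  obtain ⟨g, hg, hR⟩ := exists_rowCol_iso n k
  have hg : IsTensorIso n (.row k) .col g := hg
  rw [tensorIso_unique hn _ _ (combR_spec ⟨g, hg⟩) hg]
  exact hR x b d ⟨y, h.sum_eq.trans x.2⟩ h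

/-! ### The braid relation for a row, a letter and a column -/

/-- `g` applied to the first two factors of a triple. -/
def mapFirst {A B C : Type} (g : A × B → B × A) (p : A × B × C) : B × A × C :=
  ((g (p.1, p.2.1)).1, (g (p.1, p.2.1)).2, p.2.2)

/-- `g` applied to the last two factors of a triple. -/
def mapLast {A B C : Type} (g : B × C → C × B) (p : A × B × C) : A × C × B :=
  (p.1, g p.2)

theorem IsTensorIso.commutes_mapFirst {n : ℕ} {s t u : CrystalShape}
    {g : Tab n s × Tab n t → Tab n t × Tab n s} (hg : IsTensorIso n s t g) :
    Commutes ((tabCrystal n s).tensor ((tabCrystal n t).tensor (tabCrystal n u)))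
      ((tabCrystal n t).tensor ((tabCrystal n s).tensor (tabCrystal n u))) (mapFirst g) :=
  Commutes.assoc.comp ((Commutes.map_left ((tabCrystal_regular n s).tensor (tabCrystal_regular n t))
    ((tabCrystal_regular n t).tensor (tabCrystal_regular n s)) (tabCrystal n u) hg.2).comp
    Commutes.assoc_symm)

theorem IsTensorIso.commutes_mapLast {n : ℕ} {s t u : CrystalShape}
    {g : Tab n s × Tab n t → Tab n t × Tab n s} (hg : IsTensorIso n s t g) :
    Commutes ((tabCrystal n u).tensor ((tabCrystal n s).tensor (tabCrystal n t)))
      ((tabCrystal n u).tensor ((tabCrystal n t).tensor (tabCrystal n s))) (mapLast g) :=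
  IsCrystalIso.map_right ((tabCrystal_regular n s).tensor (tabCrystal_regular n t))
    ((tabCrystal_regular n t).tensor (tabCrystal_regular n s)) (tabCrystal n u) hg

/-- The Yang–Baxter relation for the isomorphisms `combR` on `B_s ⊗ B_t ⊗ B_u`. -/
def YangBaxterAt (n : ℕ) (s t u : CrystalShape) (p : Tab n s × Tab n t × Tab n u) : Prop :=
  mapFirst (combR n t u) (mapLast (combR n s u) (mapFirst (combR n s t) p)) =
    mapLast (combR n s t) (mapFirst (combR n s u) (mapLast (combR n t u) p))

theorem YangBaxterAt.of_eq {n : ℕ} {s t u : CrystalShape} {x x₁ x₂ x₃ : Tab n s}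
    {z z₁ z₂ z₃ : Tab n t} {b b₁ b₂ b₃ : Tab n u} (e₁ : combR n s t (x, z) = (z₁, x₁))
    (e₂ : combR n s u (x₁, b) = (b₁, x₂)) (e₃ : combR n t u (z₁, b₁) = (b₂, z₂))
    (e₄ : combR n t u (z, b) = (b₃, z₃)) (e₅ : combR n s u (x, b₃) = (b₂, x₃))
    (e₆ : combR n s t (x₃, z₃) = (z₂, x₂)) : YangBaxterAt n s t u (x, z, b) := by
  simp only [YangBaxterAt, mapFirst, mapLast, e₁, e₂, e₃, e₄, e₅, e₆]

/-- The two routes are `x ⊗ a ⊗ b ↦ c₁ ⊗ y₁ ⊗ b ↦ c₁ ⊗ d₁ ⊗ y₂ ↦ d₂ ⊗ c₂ ⊗ y₂` and `x ⊗ a ⊗ b ↦ x ⊗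
e ⊗ g ↦ d₂ ⊗ z ⊗ g ↦ d₂ ⊗ c₂ ⊗ y₂`. A row with one letter is treated as `unitVec`, so the column
rule covers it too. -/
theorem yangBaxterAt_of_rel {n l : ℕ} (hn : 2 ≤ n) {x : RowTableau n l} {a : Fin n}
    {b : ColTableau n} (c₁ c₂ g : Fin n) (d₁ d₂ e : ColTableau n) (y₁ y₂ z : Fin n → ℕ)
    (h₁ : RowLetterRel x.1 a c₁ y₁) (h₂ : RowColRel y₁ b.top b.bottom d₁.top d₁.bottom y₂)
    (h₃ : RowColRel (unitVec c₁) d₁.top d₁.bottom d₂.top d₂.bottom (unitVec c₂))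
    (h₄ : RowColRel (unitVec a) b.top b.bottom e.top e.bottom (unitVec g))
    (h₅ : RowColRel x.1 e.top e.bottom d₂.top d₂.bottom z) (h₆ : RowLetterRel z g c₂ y₂) :
    YangBaxterAt n (.row l) (.row 1) .col (x, letterRow a, b) := by
  have e₁ := combR_row_letterRow hn h₁
  have e₂ := combR_row_col (x := ⟨y₁, h₁.sum_eq.trans x.2⟩) hn h₂
  have e₃ := combR_row_col (x := letterRow c₁) hn h₃
  have e₄ := combR_row_col (x := letterRow a) hn h₄
  have e₅ := combR_row_col hn h₅
  have e₆ := combR_row_letterRow (x := ⟨z, h₅.sum_eq.trans x.2⟩) hn h₆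
  exact YangBaxterAt.of_eq e₁ e₂ e₃ e₄ e₅ e₆

/-- The witnesses are the values met along both routes; every final column is `{1,2}`. The two
elements of equal weight are separated here: they end in `{1,2} ⊗ 1 ⊗ 1^(ℓ-1) 3` and `{1,2} ⊗ 3 ⊗
1^ℓ`. -/
theorem yangBaxterAt_highest {n l : ℕ} (hn : 2 ≤ n) (hl : 1 ≤ l) {x : RowTableau n l}
    {a : Fin n} {b : ColTableau n} (hx : ∀ j : Fin n, x.1 j = if j.1 = 0 then l else 0)
    (hab : (a.1 = 0 ∧ ((b.top.1 = 0 ∧ b.bottom.1 = 1) ∨ (b.top.1 = 1 ∧ b.bottom.1 = 2))) ∨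
      (a.1 = 1 ∧ ((b.top.1 = 0 ∧ b.bottom.1 = 1) ∨ (b.top.1 = 0 ∧ b.bottom.1 = 2) ∨
        (2 ≤ l ∧ b.top.1 = 1 ∧ b.bottom.1 = 2) ∨ (b.top.1 = 2 ∧ b.bottom.1 = 3)))) :
    YangBaxterAt n (.row l) (.row 1) .col (x, letterRow a, b) := by
  have hb := b.bottom.2
  set o : Fin n := ⟨0, by omega⟩ with ho
  set w : Fin n := ⟨1, by omega⟩ with hw
  have how : o < w := by simp [ho, hw, Fin.lt_def]
  rcases hab with ⟨ha, ⟨h1, h2⟩ | ⟨h1, h2⟩⟩ | ⟨ha, ⟨h1, h2⟩ | ⟨h1, h2⟩ | ⟨hl2, h1, h2⟩ | ⟨h1, h2⟩⟩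
  · refine yangBaxterAt_of_rel hn o o o ⟨o, w, how⟩ ⟨o, w, how⟩ ⟨o, w, how⟩
      x.1 x.1 x.1 ?_ ?_ ?_ ?_ ?_ ?_ <;>
    simp only [RowLetterRel, RowColRel, unitVec, Fin.ext_iff, Fin.lt_def, Fin.le_def, hx] <;>
    grind (splits := 40)
  · set u : Fin n := ⟨2, by omega⟩ with hu
    refine yangBaxterAt_of_rel hn o o u ⟨o, w, how⟩ ⟨o, w, how⟩ ⟨o, w, how⟩
      x.1 (fun j => if j = o then l - 1 else unitVec u j) x.1 ?_ ?_ ?_ ?_ ?_ ?_ <;>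
    simp only [RowLetterRel, RowColRel, unitVec, Fin.ext_iff, Fin.lt_def, Fin.le_def, hx] <;>
    grind (splits := 40)
  · refine yangBaxterAt_of_rel hn o o w ⟨o, w, how⟩ ⟨o, w, how⟩ ⟨o, w, how⟩
      (fun j => if j = o then l - 1 else unitVec w j)
      (fun j => if j = o then l - 1 else unitVec w j) x.1 ?_ ?_ ?_ ?_ ?_ ?_ <;>
    simp only [RowLetterRel, RowColRel, unitVec, Fin.ext_iff, Fin.lt_def, Fin.le_def, hx] <;>
    grind (splits := 40)
  · set u : Fin n := ⟨2, by omega⟩ with hu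
    have hwu : w < u := by simp [hu, hw, Fin.lt_def]
    refine yangBaxterAt_of_rel hn o u o ⟨w, u, hwu⟩ ⟨o, w, how⟩ ⟨w, u, hwu⟩
      (fun j => if j = o then l - 1 else unitVec w j) x.1
      (fun j => if j = o then l - 1 else unitVec u j) ?_ ?_ ?_ ?_ ?_ ?_ <;>
    simp only [RowLetterRel, RowColRel, unitVec, Fin.ext_iff, Fin.lt_def, Fin.le_def, hx] <;>
    grind (splits := 40)
  · set u : Fin n := ⟨2, by omega⟩ with hu
    have hwu : w < u := by simp [hu, hw, Fin.lt_def]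
    refine yangBaxterAt_of_rel hn o o w ⟨o, w, how⟩ ⟨o, w, how⟩ ⟨w, u, hwu⟩
      (fun j => if j = o then l - 1 else unitVec w j)
      (fun j => if j = o then l - 2 else unitVec w j + unitVec u j)
      (fun j => if j = o then l - 1 else unitVec u j) ?_ ?_ ?_ ?_ ?_ ?_ <;>
    simp only [RowLetterRel, RowColRel, unitVec, Fin.ext_iff, Fin.lt_def, Fin.le_def, hx] <;>
    grind (splits := 40)
  · set u : Fin n := ⟨2, by omega⟩ with hu
    set v : Fin n := ⟨3, by omega⟩ with hv
    have hwu : w < u := by simp [hu, hw, Fin.lt_def]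
    refine yangBaxterAt_of_rel hn o u v ⟨w, u, hwu⟩ ⟨o, w, how⟩ ⟨w, u, hwu⟩
      (fun j => if j = o then l - 1 else unitVec w j)
      (fun j => if j = o then l - 1 else unitVec v j)
      (fun j => if j = o then l - 1 else unitVec u j) ?_ ?_ ?_ ?_ ?_ ?_ <;>
    simp only [RowLetterRel, RowColRel, unitVec, Fin.ext_iff, Fin.lt_def, Fin.le_def, hx] <;>
    grind (splits := 40)

theorem highest_triple {n l : ℕ} (hn : 2 ≤ n) {x : RowTableau n l} {a : Fin n}
    {b : ColTableau n} (h : ∀ i, ((rowCrystal n l).tensor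
      ((rowCrystal n 1).tensor (colCrystal n))).eps i (x, letterRow a, b) = 0) :
    (∀ j : Fin n, x.1 j = if j.1 = 0 then l else 0) ∧
    ((a.1 = 0 ∧ ((b.top.1 = 0 ∧ b.bottom.1 = 1) ∨ (b.top.1 = 1 ∧ b.bottom.1 = 2))) ∨
      (a.1 = 1 ∧ ((b.top.1 = 0 ∧ b.bottom.1 = 1) ∨ (b.top.1 = 0 ∧ b.bottom.1 = 2) ∨
        (2 ≤ l ∧ b.top.1 = 1 ∧ b.bottom.1 = 2) ∨ (b.top.1 = 2 ∧ b.bottom.1 = 3)))) := by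
  simp only [tensor_eps_eq_zero] at h
  have h1 := row_highest_eq hn (fun i => (h i).1)
  refine ⟨h1, ?_⟩
  -- A consequence of `ε_i(a ⊗ b) ≤ φ_i(1^ℓ)`, whose right side is `ℓ` for the first index and `0`
  -- otherwise. For `a = 2`, `b = {2,3}` it reads `2 ≤ ℓ`.
  have h2 : ∀ j, j + 1 < n → (if a.1 = j + 1 then 1 else 0) +
      (if (b.top.1 = j + 1 ∨ b.bottom.1 = j + 1) ∧ b.top.1 ≠ j ∧ b.bottom.1 ≠ j then 1 else 0) ≤
        (if j = 0 then l else 0) + if a.1 = j then 1 else 0 := by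
    intro j hj
    have := (h ⟨j, by omega⟩).2
    simp only [tensor, rowCrystal_eps _ _ hj, rowCrystal_phi _ _ hj, colCrystal_eps_mk _ _ hj,
      h1] at this
    simp only [letterRow, unitVec, Fin.ext_iff] at this
    grind
  have hlt : b.top.1 < b.bottom.1 := b.lt
  have hb := b.bottom.2
  have ha := a.2
  have h3 : a.1 = 0 ∨ a.1 = 1 := by
    have := h2 (a.1 - 1)
    grind
  have h4 := h2 (b.top.1 - 1)
  have h5 := h2 (b.bottom.1 - 1)
  grind (splits := 30)

theorem yangBaxterAt_row_letter_col {n l : ℕ} (hn : 2 ≤ n) (hl : 1 ≤ l)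
    (p : Tab n (.row l) × Tab n (.row 1) × Tab n .col) :
    YangBaxterAt n (.row l) (.row 1) .col p := by
  have h1 := combR_spec (exists_tensorIso_row n l)
  have h2 := combR_spec (exists_tensorIso_col n l)
  have h3 := combR_spec (exists_tensorIso_col n 1)
  have key := Commutes.ext
    ((tabCrystal_regular n (.row l)).tensor
      ((tabCrystal_regular n (.row 1)).tensor (tabCrystal_regular n .col)))
    (h3.commutes_mapFirst.comp (h2.commutes_mapLast.comp h1.commutes_mapFirst))
    (h1.commutes_mapLast.comp (h2.commutes_mapFirst.comp h3.commutes_mapLast)) ?_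
  · exact congrFun key p
  · rintro ⟨x, z, b⟩ h
    obtain ⟨a, rfl⟩ := exists_letterRow z
    obtain ⟨hx, hab⟩ := highest_triple hn h
    exact yangBaxterAt_highest hn hl hx hab

/-! ### The braid relation for every order of the shapes -/

/-- The map `combR` on pairs of tableaux that carry their shapes. -/
noncomputable def sigmaR (n : ℕ) (u v : Σ s : CrystalShape, Tab n s) :
    (Σ s : CrystalShape, Tab n s) × (Σ s : CrystalShape, Tab n s) :=
  (⟨v.1, (combR n u.1 v.1 (u.2, v.2)).1⟩, ⟨u.1, (combR n u.1 v.1 (u.2, v.2)).2⟩)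

theorem localR_apply {n N : ℕ} (i : ℕ) (hi : i + 1 < N) (p : TensorElt n N) (j : Fin N) :
    localR i hi p j = if j.1 = i then (sigmaR n (p ⟨i, by omega⟩) (p ⟨i + 1, hi⟩)).1
      else if j.1 = i + 1 then (sigmaR n (p ⟨i, by omega⟩) (p ⟨i + 1, hi⟩)).2 else p j := rfl

theorem sigmaR_sigmaR {n : ℕ} (hn : 2 ≤ n) {u v : Σ s : CrystalShape, Tab n s}
    (h : ∃ g, IsTensorIso n u.1 v.1 g) :
    sigmaR n (sigmaR n u v).1 (sigmaR n u v).2 = (u, v) := by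
  obtain ⟨s, x⟩ := u
  obtain ⟨t, y⟩ := v
  have := combR_combR hn h (x, y)
  simp only [sigmaR, Prod.mk.eta, this]

theorem sigmaR_self {n : ℕ} (hn : 2 ≤ n) {u v : Σ s : CrystalShape, Tab n s} (h : u.1 = v.1) :
    sigmaR n u v = (u, v) := by
  obtain ⟨s, x⟩ := u
  obtain ⟨t, y⟩ := v
  simp only at h
  subst h
  simp [sigmaR, combR_self hn]

/-- Triples of tableaux that carry their shapes. -/
abbrev TabTriple (n : ℕ) : Type :=
  (Σ s : CrystalShape, Tab n s) × (Σ s : CrystalShape, Tab n s) × (Σ s : CrystalShape, Tab n s)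

/-- The three tableaux have shapes in `basicShapes l`. -/
def TabTriple.Basic {n : ℕ} (l : ℕ) (p : TabTriple n) : Prop :=
  p.1.1 ∈ basicShapes l ∧ p.2.1.1 ∈ basicShapes l ∧ p.2.2.1 ∈ basicShapes l

/-- `sigmaR` on the first two entries of a triple. -/
noncomputable def sigmaFirst {n : ℕ} (p : TabTriple n) : TabTriple n :=
  ((sigmaR n p.1 p.2.1).1, (sigmaR n p.1 p.2.1).2, p.2.2)

/-- `sigmaR` on the last two entries of a triple. -/
noncomputable def sigmaLast {n : ℕ} (p : TabTriple n) : TabTriple n :=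
  (p.1, sigmaR n p.2.1 p.2.2)

/-- The Yang–Baxter relation at a triple. -/
def SigmaYangBaxter {n : ℕ} (p : TabTriple n) : Prop :=
  sigmaFirst (sigmaLast (sigmaFirst p)) = sigmaLast (sigmaFirst (sigmaLast p))

theorem TabTriple.Basic.sigmaFirst {n l : ℕ} {p : TabTriple n} (h : p.Basic l) :
    (sigmaFirst p).Basic l :=
  ⟨h.2.1, h.1, h.2.2⟩

theorem TabTriple.Basic.sigmaLast {n l : ℕ} {p : TabTriple n} (h : p.Basic l) :
    (sigmaLast p).Basic l :=
  ⟨h.1, h.2.2, h.2.1⟩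

theorem sigmaFirst_sigmaFirst {n l : ℕ} (hn : 2 ≤ n) {p : TabTriple n} (h : p.Basic l) :
    sigmaFirst (sigmaFirst p) = p := by
  have := sigmaR_sigmaR hn (u := p.1) (v := p.2.1) (exists_tensorIso h.1 h.2.1)
  simp only [sigmaFirst, this]

theorem sigmaLast_sigmaLast {n l : ℕ} (hn : 2 ≤ n) {p : TabTriple n} (h : p.Basic l) :
    sigmaLast (sigmaLast p) = p := by
  have := sigmaR_sigmaR hn (u := p.2.1) (v := p.2.2) (exists_tensorIso h.2.1 h.2.2)
  simp only [sigmaLast, this]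

theorem sigmaFirst_self {n : ℕ} (hn : 2 ≤ n) {p : TabTriple n} (h : p.1.1 = p.2.1.1) :
    sigmaFirst p = p := by
  simp only [sigmaFirst, sigmaR_self hn h]

theorem sigmaLast_self {n : ℕ} (hn : 2 ≤ n) {p : TabTriple n} (h : p.2.1.1 = p.2.2.1) :
    sigmaLast p = p := by
  simp only [sigmaLast, sigmaR_self hn h]

/-- With `F`, `L` the two involutions, the relation at `F p` reads `F L p = L F L F p`; applying `L`
gives it at `p`. -/
theorem SigmaYangBaxter.of_sigmaFirst {n l : ℕ} (hn : 2 ≤ n) {p : TabTriple n} (h : p.Basic l)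
    (hp : SigmaYangBaxter (sigmaFirst p)) : SigmaYangBaxter p := by
  unfold SigmaYangBaxter at *
  rw [sigmaFirst_sigmaFirst hn h] at hp
  rw [hp, sigmaLast_sigmaLast hn h.sigmaFirst.sigmaLast.sigmaFirst]

theorem SigmaYangBaxter.of_sigmaLast {n l : ℕ} (hn : 2 ≤ n) {p : TabTriple n} (h : p.Basic l)
    (hp : SigmaYangBaxter (sigmaLast p)) : SigmaYangBaxter p := by
  unfold SigmaYangBaxter at *
  rw [sigmaLast_sigmaLast hn h] at hp
  rw [← hp, sigmaFirst_sigmaFirst hn h.sigmaLast.sigmaFirst.sigmaLast]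

theorem sigmaYangBaxter_of_eq_first {n : ℕ} (hn : 2 ≤ n) {p : TabTriple n}
    (h : p.1.1 = p.2.1.1) : SigmaYangBaxter p := by
  unfold SigmaYangBaxter
  rw [sigmaFirst_self hn h, sigmaLast_self hn (p := sigmaFirst (sigmaLast p)) h]

theorem sigmaYangBaxter_of_eq_last {n : ℕ} (hn : 2 ≤ n) {p : TabTriple n}
    (h : p.2.1.1 = p.2.2.1) : SigmaYangBaxter p := by
  unfold SigmaYangBaxter
  rw [sigmaLast_self hn h, sigmaFirst_self hn (p := sigmaLast (sigmaFirst p)) h]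

theorem sigmaYangBaxter_row_letter_col {n l : ℕ} (hn : 2 ≤ n) (hl : 1 ≤ l) {p : TabTriple n}
    (h₁ : p.1.1 = .row l) (h₂ : p.2.1.1 = .row 1) (h₃ : p.2.2.1 = .col) : SigmaYangBaxter p := by
  obtain ⟨⟨s, x⟩, ⟨t, y⟩, ⟨u, z⟩⟩ := p
  simp only at h₁ h₂ h₃
  subst h₁ h₂ h₃
  have h := yangBaxterAt_row_letter_col hn hl (x, y, z)
  simp only [YangBaxterAt, mapFirst, mapLast, Prod.mk.injEq] at h
  obtain ⟨h1, h2⟩ := h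
  rw [Prod.ext_iff] at h2
  simp only [SigmaYangBaxter, sigmaFirst, sigmaLast, sigmaR, Prod.mk.injEq, Sigma.mk.injEq,
    heq_eq_eq, true_and]
  exact ⟨h1, h2⟩

theorem sigmaYangBaxter_of_basic {n l : ℕ} (hn : 2 ≤ n) (hl : 1 ≤ l) {p : TabTriple n}
    (h : p.Basic l) : SigmaYangBaxter p := by
  by_cases h12 : p.1.1 = p.2.1.1
  · exact sigmaYangBaxter_of_eq_first hn h12
  by_cases h23 : p.2.1.1 = p.2.2.1
  · exact sigmaYangBaxter_of_eq_last hn h23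
  by_cases h13 : p.1.1 = p.2.2.1
  -- Exchanging the last two factors makes the equal shapes adjacent.
  · exact .of_sigmaLast hn h (sigmaYangBaxter_of_eq_first hn h13)
  have base {q : TabTriple n} := sigmaYangBaxter_row_letter_col hn hl (p := q)
  have hF := h.sigmaFirst
  have hL := h.sigmaLast
  -- Pairwise distinct shapes are a permutation of `(ℓ), (1), (1,1)`, and each alternative sorts one
  -- permutation by adjacent exchanges.
  rcases h.1 with h1 | h1 | h1 <;> rcases h.2.1 with h2 | h2 | h2 <;>
    rcases h.2.2 with h3 | h3 | h3 <;>
    first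
    | exact absurd (h1.trans h2.symm) h12
    | exact absurd (h2.trans h3.symm) h23
    | exact absurd (h1.trans h3.symm) h13
    | exact base h1 h2 h3
    | exact .of_sigmaFirst hn h (base h2 h1 h3)
    | exact .of_sigmaLast hn h (base h1 h3 h2)
    | exact .of_sigmaFirst hn h (.of_sigmaLast hn hF (base h2 h3 h1))
    | exact .of_sigmaLast hn h (.of_sigmaFirst hn hL (base h3 h1 h2))
    | exact .of_sigmaFirst hn h (.of_sigmaLast hn hF
        (.of_sigmaFirst hn hF.sigmaLast (base h3 h2 h1)))

/-! ### Transfer to products of `N` factors -/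

theorem localR_eq_left {n N : ℕ} (i : ℕ) (hi : i + 1 < N) (p : TensorElt n N) :
    localR i hi p ⟨i, by omega⟩ = (sigmaR n (p ⟨i, by omega⟩) (p ⟨i + 1, hi⟩)).1 := by
  simp [localR_apply]

theorem localR_eq_right {n N : ℕ} (i : ℕ) (hi : i + 1 < N) (p : TensorElt n N) :
    localR i hi p ⟨i + 1, hi⟩ = (sigmaR n (p ⟨i, by omega⟩) (p ⟨i + 1, hi⟩)).2 := by
  simp [localR_apply]

theorem localR_of_ne {n N : ℕ} (i : ℕ) (hi : i + 1 < N) (p : TensorElt n N) (j : Fin N)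
    (h : j.1 ≠ i) (h' : j.1 ≠ i + 1) : localR i hi p j = p j := by
  simp [localR_apply, h, h']

theorem localR_localR {n N l : ℕ} (hn : 2 ≤ n) (p : TensorElt n N)
    (hp : ∀ j, (p j).1 ∈ basicShapes l) (i : ℕ) (hi : i + 1 < N) :
    localR i hi (localR i hi p) = p := by
  funext j
  have key := sigmaR_sigmaR hn (exists_tensorIso (hp ⟨i, by omega⟩) (hp ⟨i + 1, hi⟩))
  by_cases h : j.1 = i
  · obtain rfl : j = ⟨i, Nat.lt_of_succ_lt hi⟩ := Fin.ext h
    rw [localR_eq_left, localR_eq_left, localR_eq_right, key]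
  by_cases h' : j.1 = i + 1
  · obtain rfl : j = ⟨i + 1, hi⟩ := Fin.ext h'
    rw [localR_eq_right, localR_eq_left, localR_eq_right, key]
  · rw [localR_of_ne _ _ _ _ h h', localR_of_ne _ _ _ _ h h']

theorem localR_comm {n N : ℕ} (p : TensorElt n N) (i j : ℕ) (hi : i + 1 < N) (hj : j + 1 < N)
    (hij : i + 2 ≤ j) : localR i hi (localR j hj p) = localR j hj (localR i hi p) := by
  funext k
  simp only [localR_apply]
  have h1 : i ≠ j := by omega
  have h2 : i ≠ j + 1 := by omega
  have h3 : i + 1 ≠ j := by omega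
  have h4 : i + 1 ≠ j + 1 := by omega
  simp only [h1, h2, h3, h4, h1.symm, h2.symm, h3.symm, h4.symm, if_false]
  split_ifs <;> first | rfl | omega

/-- Both sides alter only positions `i`, `i + 1`, `i + 2`, and on these three entries the maps are
`sigmaFirst` and `sigmaLast`. -/
theorem localR_braid {n N l : ℕ} (hn : 2 ≤ n) (hl : 1 ≤ l) (p : TensorElt n N)
    (hp : ∀ j, (p j).1 ∈ basicShapes l) (i : ℕ) (hi : i + 1 < N) (hi' : i + 1 + 1 < N) :
    localR i hi (localR (i + 1) hi' (localR i hi p)) =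
      localR (i + 1) hi' (localR i hi (localR (i + 1) hi' p)) := by
  have hF : ∀ q : TensorElt n N, ((localR i hi q ⟨i, by omega⟩, localR i hi q ⟨i + 1, hi⟩,
      localR i hi q ⟨i + 1 + 1, hi'⟩) : TabTriple n) =
      sigmaFirst (q ⟨i, by omega⟩, q ⟨i + 1, hi⟩, q ⟨i + 1 + 1, hi'⟩) := by
    intro q
    rw [localR_eq_left, localR_eq_right,
      localR_of_ne _ _ _ _ (by simp only; omega) (by simp only; omega)]
    rfl
  have hL : ∀ q : TensorElt n N, ((localR (i + 1) hi' q ⟨i, by omega⟩,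
      localR (i + 1) hi' q ⟨i + 1, hi⟩, localR (i + 1) hi' q ⟨i + 1 + 1, hi'⟩) : TabTriple n) =
      sigmaLast (q ⟨i, by omega⟩, q ⟨i + 1, hi⟩, q ⟨i + 1 + 1, hi'⟩) := by
    intro q
    rw [localR_eq_left, localR_eq_right,
      localR_of_ne _ _ _ _ (by simp only; omega) (by simp only; omega)]
    rfl
  have key := sigmaYangBaxter_of_basic hn hl
    (p := (p ⟨i, by omega⟩, p ⟨i + 1, hi⟩, p ⟨i + 1 + 1, hi'⟩))
    ⟨hp ⟨i, by omega⟩, hp ⟨i + 1, hi⟩, hp ⟨i + 1 + 1, hi'⟩⟩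
  rw [SigmaYangBaxter, ← hF, ← hL, ← hF, ← hL, ← hF, ← hL] at key
  simp only [Prod.mk.injEq] at key
  funext j
  by_cases h : j.1 = i
  · obtain rfl : j = ⟨i, Nat.lt_of_succ_lt hi⟩ := Fin.ext h
    exact key.1
  by_cases h' : j.1 = i + 1
  · obtain rfl : j = ⟨i + 1, hi⟩ := Fin.ext h'
    exact key.2.1
  by_cases h'' : j.1 = i + 1 + 1
  · obtain rfl : j = ⟨i + 1 + 1, hi'⟩ := Fin.ext h''
    exact key.2.2
  · simp only [localR_of_ne _ _ _ _ h h', localR_of_ne _ _ _ _ h' h'']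

theorem mainTheorem2 (n : ℕ) (hn : 2 ≤ n) (l : ℕ) (hl : 1 ≤ l) :
    (∀ s ∈ basicShapes l, ∀ t ∈ basicShapes l,
      IsTensorIso n s t (combR n s t) ∧
        ∀ g : Tab n s × Tab n t → Tab n t × Tab n s, IsTensorIso n s t g → g = combR n s t) ∧
    ∀ (N : ℕ) (p : TensorElt n N), (∀ j, (p j).1 ∈ basicShapes l) →
      (∀ (i : ℕ) (hi : i + 1 < N), localR i hi (localR i hi p) = p) ∧
      (∀ (i j : ℕ) (hi : i + 1 < N) (hj : j + 1 < N), 2 ≤ |(i : ℤ) - (j : ℤ)| →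
        localR i hi (localR j hj p) = localR j hj (localR i hi p)) ∧
      (∀ (i : ℕ) (hi : i + 1 < N) (hi' : i + 1 + 1 < N),
        localR i hi (localR (i + 1) hi' (localR i hi p)) =
          localR (i + 1) hi' (localR i hi (localR (i + 1) hi' p))) := by
  refine ⟨fun s hs t ht => ?_, fun N p hp => ⟨localR_localR hn p hp, fun i j hi hj hij => ?_,
    localR_braid hn hl p hp⟩⟩
  · have h := combR_spec (exists_tensorIso (n := n) hs ht)
    exact ⟨h, fun g hg => tensorIso_unique hn s t hg h⟩
  · rcases le_abs.1 hij with h | h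
    · exact (localR_comm p j i hj hi (by omega)).symm
    · exact localR_comm p i j hi hj (by omega)
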